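/- **Setting.** Let $\Omega\subset\mathbb R^d$ be compact and convex, let $\mathcal P(\Omega)$ be the set of Borel probability measures on $\mathbb R^d$ concentrated on $\Omega$, and let $$\mathrm W(\mu,\nu)=\inf\Big\{\int|x-y|^2\,d\pi(x,y)\ :\ \pi\text{ a coupling of }\mu,\nu\Big\}^{1/2}$$ be the Wasserstein-2 distance. For a curve $\rho\in\mathrm{Lip}([0,1];(\mathcal P(\Omega),\mathrm W))$ let $\mathcal{CE}(\rho)$ be the set of measurable velocity fields $v$ with $v(t)\in L^2(\rho(t);\mathbb R^d)$ for $t\in[0,1]$ such that $$\int_0^1\!\!\int_\Omega\partial_t\phi\,d\rho(t)\,dt+\int_0^1\!\!\int_\Omega\langle\nabla\phi,v(t)\rangle\,d\rho(t)\,dt=\int_\Omega\phi(1,\cdot)\,d\rho(1)-\int_\Omega\phi(0,\cdot)\,d\rho(0)$$ for all $\phi\in C^1([0,1]\times\Omega)$, and set $\mathrm{energy}(\rho)=\inf\{\int_0^1\|v(t)\|^2_{L^2(\rho(t))}dt : v\in\mathcal{CE}(\rho)\}$. Assume the following. 1. $\mathcal S$ is a compact connected finite-dimensional smooth Riemannian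 manifold, possibly with boundary, with tangent norms $\|\cdot\|_\theta$ and Riemannian distance $d_{\mathcal S}$. There is a set $\mathcal D\subset T\mathcal S$, with fibres $\mathcal D_\theta$, on which the Riemannian exponential map is defined, such that $(\theta,\eta)\in\mathcal D$ implies $(\theta,t\eta)\in\mathcal D$ for $t\in[0,1]$; for $(\theta,\eta)\in\mathcal D$ the geodesic $\gamma(t)=\exp_\theta(t\eta)$, $t\in[0,1]$, stays in $\mathcal S$ and satisfies $\|\dot\gamma(t)\|_{\gamma(t)}=\|\eta\|_\theta=d_{\mathcal S}(\theta,\exp_\theta(\eta))$; and for all $\theta_0,\theta_1\in\mathcal S$ there is $\eta\in\mathcal D_{\theta_0}$ with $\exp_{\theta_0}(\eta)=\theta_1$. 2. $E:\mathcal S\to\mathcal P(\Omega)$, $\theta\mapsto\lambda_\theta$, is bi-Lipschitz onto $\Lambda:=E(\mathcal S)$ with respect to $d_{\mathcal S}$ and $\mathrm W$, and every $\lambda_\theta$ is absolutely continuous with respect to Lebesgue measure. 3. For each $\theta\in\mathcal S$, $B_\theta$ is a linear map from $T_\theta\mathcal S$ to $C^1$ gradient vector fields on $\mathbb R^d$,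 and there is $C\in(0,\infty)$ such that for all $(\theta,\eta)\in\mathcal D$, with $\gamma(t)=\exp_\theta(t\eta)$, $$\tfrac1C\|\eta\|_\theta\le\|B_\theta\eta\|_{L^2(\lambda_\theta)}\le C\|\eta\|_\theta,\qquad \|B_\theta\eta\|_{C^1(\mathbb R^d)}\le C\|\eta\|_\theta,\qquad \big|\partial_t[B_{\gamma(t)}\dot\gamma(t)](x)\big|\le C\|\eta\|_\theta^2$$ for all $x\in\mathbb R^d$, $t\in[0,1]$ (the time derivative being assumed to exist). 4. For every $\gamma\in\mathrm{Lip}([0,1];\mathcal S)$, if $\varphi:[0,1]\times\Omega\to\mathbb R^d$ is the flow $\varphi(0,x)=x$, $\partial_t\varphi(t,x)=[B_{\gamma(t)}\dot\gamma(t)](\varphi(t,x))$ for a.e. $t$ (with $\varphi$ absolutely continuous in $t$), then $\lambda_{\gamma(t)}=\varphi(t,\cdot)_\#\lambda_{\gamma(0)}$ for all $t\in[0,1]$. For $\mu,\nu\in\Lambda$ and $\gamma\in\mathrm{Lip}([0,1];(\mathcal S,d_{\mathcal S}))$ let $$\mathrm W_\Lambda(\mu,\nu)=\inf\{\mathrm{energy}(\rho)^{1/2}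 : \rho\in\mathrm{Lip}([0,1];(\Lambda,\mathrm W)),\ \rho(0)=\mu,\ \rho(1)=\nu\},$$ $$\mathrm{energy}_{\mathcal S}(\gamma)=\int_0^1\|B_{\gamma(t)}\dot\gamma(t)\|^2_{L^2(\lambda_{\gamma(t)})}\,dt,\qquad d_\Lambda(\theta_0,\theta_1)=\mathrm W_\Lambda(\lambda_{\theta_0},\lambda_{\theta_1}).$$ **Statement.** For all $\theta_0,\theta_1\in\mathcal S$, $$d_\Lambda(\theta_0,\theta_1)=\inf\{\mathrm{energy}_{\mathcal S}(\gamma)^{1/2} : \gamma\in\mathrm{Lip}([0,1];(\mathcal S,d_{\mathcal S})),\ \gamma(0)=\theta_0,\ \gamma(1)=\theta_1\}.$$ Moreover $d_{\mathcal S}$ and $d_\Lambda$ are equivalent metrics on $\mathcal S$, and $\mathrm W$ and $\mathrm W_\Lambda$ are equivalent metrics on $\Lambda$; here two metrics are equivalent if each is bounded by a constant multiple of the other. Finally, $(\Lambda,\mathrm W_\Lambda)$ is a compact metric space. -/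

import Mathlib

open Set MeasureTheory Bundle
open scoped Manifold ContDiff ENNReal NNReal

noncomputable section

namespace WSub

/-! ### Probability measures on `Ω`, the Wasserstein-2 distance, the energy of a curve -/

/-- `ℝ^d` with its Euclidean norm. -/
abbrev V (d : ℕ) : Type := EuclideanSpace ℝ (Fin d)

/-- `prob(Ω)`: Borel probability measures on `ℝ^d` that are concentrated on `Ω`. -/
abbrev ProbOn {d : ℕ} (Ω : Set (V d)) : Type :=
  {μ : Measure (V d) // IsProbabilityMeasure μ ∧ μ Ωᶜ = 0}

/-- The Wasserstein-2 distance: the square root of the infimum of `∫ |x - y|² dq` over couplings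
`q` of `μ` and `ν`. -/
def W {d : ℕ} {Ω : Set (V d)} (μ ν : ProbOn Ω) : ℝ≥0∞ :=
  (⨅ q ∈ {q : Measure (V d × V d) | q.map Prod.fst = μ.1 ∧ q.map Prod.snd = ν.1},
    ∫⁻ p, ‖p.1 - p.2‖ₑ ^ 2 ∂q) ^ (1 / 2 : ℝ)

/-- `ρ ∈ Lip([0,1]; (prob(Ω), W))`; values of `ρ` outside of `[0,1]` are irrelevant. -/
def IsLipCurve {d : ℕ} {Ω : Set (V d)} (ρ : ℝ → ProbOn Ω) : Prop :=
  ∃ L : ℝ≥0, ∀ s ∈ Icc (0 : ℝ) 1, ∀ t ∈ Icc (0 : ℝ) 1, W (ρ s) (ρ t) ≤ L * edist s t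

/-- `CE(ρ)`: measurable velocity fields `v(t) ∈ L²(ρ(t); ℝ^d)` that satisfy the continuity
equation with `ρ` in the distributional sense, with `C¹` test functions `φ(t,x)`. Here
`fderiv ℝ φ (t, x) (1, 0) = ∂_t φ(t,x)` and `fderiv ℝ φ (t, x) (0, u) = ⟨∇φ(t,x), u⟩`. -/
def CE {d : ℕ} {Ω : Set (V d)} (ρ : ℝ → ProbOn Ω) : Set (ℝ → V d → V d) :=
  {v | Measurable (fun p : ℝ × V d => v p.1 p.2) ∧
    (∀ t ∈ Icc (0 : ℝ) 1, MemLp (v t) 2 (ρ t).1) ∧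
    ∀ φ : ℝ × V d → ℝ, ContDiff ℝ 1 φ →
      (∫ t in Icc (0 : ℝ) 1, ∫ x, fderiv ℝ φ (t, x) (1, 0) ∂(ρ t).1) +
        (∫ t in Icc (0 : ℝ) 1, ∫ x, fderiv ℝ φ (t, x) (0, v t x) ∂(ρ t).1) =
      (∫ x, φ (1, x) ∂(ρ 1).1) - ∫ x, φ (0, x) ∂(ρ 0).1}

/-- `energy(ρ) = inf { ∫₀¹ ‖v(t)‖²_{L²(ρ(t))} dt | v ∈ CE(ρ) }`. -/
def energy {d : ℕ} {Ω : Set (V d)} (ρ : ℝ → ProbOn Ω) : ℝ≥0∞ :=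
  ⨅ v ∈ CE ρ, ∫⁻ t in Icc (0 : ℝ) 1, ∫⁻ x, ‖v t x‖ₑ ^ 2 ∂(ρ t).1

/-- The geodesic restriction `W_Λ` of `W` to a set `Λ` of measures: only curves that stay in `Λ`
are admitted. -/
def WRestr {d : ℕ} {Ω : Set (V d)} (Λ : Set (ProbOn Ω)) (μ ν : ProbOn Ω) : ℝ≥0∞ :=
  ⨅ ρ ∈ {ρ : ℝ → ProbOn Ω | IsLipCurve ρ ∧ (∀ t ∈ Icc (0 : ℝ) 1, ρ t ∈ Λ) ∧ ρ 0 = μ ∧ ρ 1 = ν},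
    energy ρ ^ (1 / 2 : ℝ)

/-! ### Metrics on a set -/

/-- `δ` restricted to `A` is a (finite) metric. -/
structure IsMetricOn {X : Type*} (A : Set X) (δ : X → X → ℝ≥0∞) : Prop where
  finite : ∀ x ∈ A, ∀ y ∈ A, δ x y ≠ ⊤
  eq_zero_iff : ∀ x ∈ A, ∀ y ∈ A, δ x y = 0 ↔ x = y
  symm : ∀ x ∈ A, ∀ y ∈ A, δ x y = δ y x
  triangle : ∀ x ∈ A, ∀ y ∈ A, ∀ z ∈ A, δ x z ≤ δ x y + δ y z

/-- `δ₁` and `δ₂` are metrics on `A`, and each is bounded by a constant multiple of the other. -/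
structure AreEquivalentMetricsOn {X : Type*} (A : Set X) (δ₁ δ₂ : X → X → ℝ≥0∞) : Prop where
  left : IsMetricOn A δ₁
  right : IsMetricOn A δ₂
  bounds : ∃ C : ℝ≥0, 0 < C ∧ ∀ x ∈ A, ∀ y ∈ A, δ₁ x y ≤ C * δ₂ x y ∧ δ₂ x y ≤ C * δ₁ x y

/-! ### Curves and geodesics in a Riemannian manifold, possibly with boundary -/

section Geodesics

variable {F : Type*} [NormedAddCommGroup F] [NormedSpace ℝ F]
  {H : Type*} [TopologicalSpace H] (I : ModelWithCorners ℝ F H)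
  {S : Type*} [TopologicalSpace S] [ChartedSpace H S]

/-- The velocity `γ'(t) ∈ T_{γ(t)} S` of a curve `γ : [0,1] → S` (zero where it does not exist). -/
def velocity (γ : ℝ → S) (t : ℝ) : TangentSpace I (γ t) :=
  mfderivWithin 𝓘(ℝ, ℝ) I γ (Icc 0 1) t (1 : ℝ)

variable [RiemannianBundle (fun x : S => TangentSpace I x)]

/-- The Riemannian tensor in the chart at `x₀`: the number `g_y(a, b)` for chart coordinates `y`
and coordinate vectors `a`, `b`. -/
def chartMetric (x₀ : S) (a b : F) (y : F) : ℝ :=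
  inner ℝ
    (mfderivWithin 𝓘(ℝ, F) I (extChartAt I x₀).symm (range I) y a :
      TangentSpace I ((extChartAt I x₀).symm y))
    (mfderivWithin 𝓘(ℝ, F) I (extChartAt I x₀).symm (range I) y b)

/-- `∂_w g(a, b)` at `y`, in the chart at `x₀`. -/
def chartMetricDeriv (x₀ : S) (w a b : F) (y : F) : ℝ :=
  fderivWithin ℝ (chartMetric I x₀ a b) (range I) y w

/-- `γ : [0,1] → S` is a geodesic (parametrized proportionally to arc length): it is `C²` and its
coordinates `u` in every chart satisfy the geodesic equation, written here with lowered index,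
`g(u'', w) + (∂_{u'} g)(u', w) - ½ (∂_w g)(u', u') = 0` for every coordinate vector `w`. -/
def IsGeodesic (γ : ℝ → S) : Prop :=
  ContMDiffOn 𝓘(ℝ, ℝ) I 2 γ (Icc 0 1) ∧
  ∀ x₀ : S, ∀ t ∈ Icc (0 : ℝ) 1, γ t ∈ (chartAt H x₀).source →
    let u : ℝ → F := fun s => extChartAt I x₀ (γ s)
    let u' : F := derivWithin u (Icc 0 1) t
    let u'' : F := derivWithin (derivWithin u (Icc 0 1)) (Icc 0 1) t
    ∀ w : F, chartMetric I x₀ u'' w (u t) + chartMetricDeriv I x₀ u' u' w (u t)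
      - (1 / 2) * chartMetricDeriv I x₀ w u' u' (u t) = 0

/-- `γ` is a geodesic on `[0,1]` with `γ(0) = θ` and `γ'(0) = η`. -/
def IsGeodesicFrom (θ : S) (η : TangentSpace I θ) (γ : ℝ → S) : Prop :=
  IsGeodesic I γ ∧
    (⟨γ 0, velocity I γ 0⟩ : TangentBundle I S) = (⟨θ, η⟩ : TangentBundle I S)

open Classical in
/-- The curve `t ↦ exp_θ(t η)`, `t ∈ [0,1]`, that is, the (unique) geodesic on `[0,1]` with initial
point `θ` and initial velocity `η`; constant if there is none, i.e. if `exp_θ(η)` is undefined. -/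
def expCurve (θ : S) (η : TangentSpace I θ) : ℝ → S :=
  if h : ∃ γ : ℝ → S, IsGeodesicFrom I θ η γ then h.choose else fun _ => θ

/-- `γ ∈ Lip([0,1]; S)`; values of `γ` outside of `[0,1]` are irrelevant. -/
def IsLipPath {S : Type*} [PseudoEMetricSpace S] (γ : ℝ → S) : Prop :=
  ∃ L : ℝ≥0, LipschitzOnWith L γ (Icc 0 1)

end Geodesics

/-- `φ : [0,1] × Ω → ℝ^d` is the flow of the time-dependent vector field `v`: `φ(0,x) = x` and
`∂_t φ(t,x) = v(t, φ(t,x))` for a.e. `t`, with `φ` absolutely continuous in `t` (equivalently, the integral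
equation below: the time-dependent field need not be continuous in `t`). -/
def IsFlow {d : ℕ} (Ω : Set (V d)) (v φ : ℝ → V d → V d) : Prop :=
  ∀ x ∈ Ω, IntervalIntegrable (fun s => v s (φ s x)) volume 0 1 ∧
    ∀ t ∈ Icc (0 : ℝ) 1, φ t x = x + ∫ s in (0 : ℝ)..t, v s (φ s x)

/-! ### Parametrized submanifolds of Wasserstein space -/

/-- A submanifold of `(prob(Ω), W)` parametrized by the Riemannian manifold `S`. -/
structure Model {F : Type*} [NormedAddCommGroup F] [NormedSpace ℝ F]
    {H : Type*} [TopologicalSpace H] (I : ModelWithCorners ℝ F H)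
    (S : Type*) [MetricSpace S] [ChartedSpace H S] [IsManifold I ∞ S]
    [RiemannianBundle (fun x : S => TangentSpace I x)] {d : ℕ} (Ω : Set (V d)) where
  /-- `𝒟_θ ⊆ T_θ S`, the fibres of a set `𝒟 ⊆ TS` on which the exponential map is defined and
  produces minimizing geodesics. -/
  D : ∀ θ : S, Set (TangentSpace I θ)
  exp_defined : ∀ θ, ∀ η ∈ D θ, ∃ γ : ℝ → S, IsGeodesicFrom I θ η γ
  D_star : ∀ θ, ∀ η ∈ D θ, ∀ t ∈ Icc (0 : ℝ) 1, t • η ∈ D θ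
  D_speed : ∀ θ, ∀ η ∈ D θ, ∀ t ∈ Icc (0 : ℝ) 1, ‖velocity I (expCurve I θ η) t‖ = ‖η‖
  D_dist : ∀ θ, ∀ η ∈ D θ, ‖η‖ = dist θ (expCurve I θ η 1)
  D_joins : ∀ θ₀ θ₁ : S, ∃ η ∈ D θ₀, expCurve I θ₀ η 1 = θ₁
  /-- The embedding `θ ↦ λ_θ`. -/
  E : S → ProbOn Ω
  E_bilipschitz : ∃ C : ℝ≥0, 0 < C ∧
    ∀ θ θ', W (E θ) (E θ') ≤ C * edist θ θ' ∧ edist θ θ' ≤ C * W (E θ) (E θ')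
  E_absolutelyContinuous : ∀ θ, (E θ).1 ≪ volume
  /-- The velocity field maps `B_θ`. -/
  B : ∀ θ : S, TangentSpace I θ →ₗ[ℝ] (V d → V d)
  B_contDiff : ∀ θ η, ContDiff ℝ 1 (B θ η)
  B_gradient : ∀ θ η, ∃ f : V d → ℝ, ∀ x, HasGradientAt f (B θ η x) x
  /-- `‖B_θ η‖_{L²(λ_θ)} ∈ [1/C, C] ‖η‖_θ`, `‖B_θ η‖_{C¹(ℝ^d)} ≤ C ‖η‖_θ`, and
  `|∂_t [B_{γ(t)} γ'(t)](x)| ≤ C ‖η‖_θ²` along `γ(t) = exp_θ(t η)`. -/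
  B_bounds : ∃ C : ℝ≥0, 0 < C ∧ ∀ θ, ∀ η ∈ D θ,
    (‖η‖ₑ ≤ C * eLpNorm (B θ η) 2 (E θ).1 ∧ eLpNorm (B θ η) 2 (E θ).1 ≤ C * ‖η‖ₑ) ∧
    (∀ x, ‖B θ η x‖ ≤ C * ‖η‖ ∧ ‖fderiv ℝ (B θ η) x‖ ≤ C * ‖η‖) ∧
    ∀ x, ∀ t ∈ Icc (0 : ℝ) 1,
      let b : ℝ → V d := fun s => B (expCurve I θ η s) (velocity I (expCurve I θ η) s) x
      DifferentiableWithinAt ℝ b (Icc 0 1) t ∧ ‖derivWithin b (Icc 0 1) t‖ ≤ C * ‖η‖ ^ 2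
  /-- Along every Lipschitz curve `γ`, the flow `φ` of `v(t) = B_{γ(t)} γ'(t)` satisfies
  `λ_{γ(t)} = φ(t,·)_# λ_{γ(0)}`. -/
  consistent : ∀ γ : ℝ → S, IsLipPath γ → ∀ φ : ℝ → V d → V d,
    IsFlow Ω (fun t => B (γ t) (velocity I γ t)) φ →
      ∀ t ∈ Icc (0 : ℝ) 1, (E (γ t)).1 = (E (γ 0)).1.map (φ t)

namespace Model

variable {F : Type*} [NormedAddCommGroup F] [NormedSpace ℝ F]
  {H : Type*} [TopologicalSpace H] {I : ModelWithCorners ℝ F H}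
  {S : Type*} [MetricSpace S] [ChartedSpace H S] [IsManifold I ∞ S]
  [RiemannianBundle (fun x : S => TangentSpace I x)] {d : ℕ} {Ω : Set (V d)}

/-- `Λ = E(S)`. -/
def Lam (M : Model I S Ω) : Set (ProbOn Ω) := range M.E

/-- `W_Λ`. -/
def WLam (M : Model I S Ω) (μ ν : ProbOn Ω) : ℝ≥0∞ := WRestr M.Lam μ ν

/-- `d_Λ(θ₀, θ₁) = W_Λ(λ_{θ₀}, λ_{θ₁})`. -/
def dLam (M : Model I S Ω) (θ₀ θ₁ : S) : ℝ≥0∞ := M.WLam (M.E θ₀) (M.E θ₁)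

/-- `energy_S(γ) = ∫₀¹ ‖B_{γ(t)} γ'(t)‖²_{L²(λ_{γ(t)})} dt`. -/
def energyS (M : Model I S Ω) (γ : ℝ → S) : ℝ≥0∞ :=
  ∫⁻ t in Icc (0 : ℝ) 1, ∫⁻ x, ‖M.B (γ t) (velocity I γ t) x‖ₑ ^ 2 ∂(M.E (γ t)).1

end Model

end WSub

end

open Set MeasureTheory Bundle Filter Topology
open scoped Manifold ContDiff ENNReal NNReal

noncomputable section

/-! The embedding `E` is bi-Lipschitz, so Lipschitz curves in `Λ` are exactly the images of
Lipschitz curves in `S`. Everything therefore rests on one identity: `energy ρ = M.energyS γ`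
whenever `ρ = E ∘ γ` on `[0,1]`.

For `≤`, the field `w(t) = B_{γ(t)} γ'(t)` must belong to `CE ρ`. It is bounded and Lipschitz in
space, so it has a flow. The consistency hypothesis says that this flow transports `ρ`, and the
chain rule along trajectories gives the continuity equation (`IsTransport.mem_CE`).

For `≥`, the field `w` must have least kinetic energy in `CE ρ`. Any competitor `v` differs from `w`
by a field orthogonal, at almost every time, to each fixed bounded continuous gradient field. It
suffices that `w` is a limit of gradient fields that are piecewise constant in time; then `v - w` is
orthogonal to `w` and Pythagoras applies (`kinetic_le_of_mem_CE`).

The approximants are `n B_{γ(k/n)} η`, where `η ∈ 𝒟` is the logarithm of `γ((k+1)/n)` at `γ(k/n)`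
(`Model.exists_isStepLimit`). This also yields the measurability and the bounds for `w`. Convergence
is the delicate point, because the bounds on `B` concern only vectors of `𝒟`, and the variation of
`B` in `θ` is controlled only along the given geodesics. In a chart, the geodesic equation gives
second order estimates for logarithms (`exists_log_estimates`). Differences of logarithms nearly
form a basis, so `B` is locally bounded on whole tangent spaces (`exists_norm_le_of_bounded_on_D`).
Together these show that `B` varies little along a displacement (`exists_B_local`), which is enough
at the points where `γ` is differentiable, that is, almost everywhere.

The metric statements follow from `W ≤ W_Λ ≤ C d_S ≤ C' W` along `E`: the flow is a transport plan
whose cost is at most the energy, and minimizing geodesics are competitors in `S`. Symmetry and the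
triangle inequality come from reversing and concatenating curves. Compactness is inherited from `S`
through a Lipschitz surjection. -/

namespace WSub

/-! ### Tangent vectors and the Riemannian tensor in a chart. -/

section Chart

set_option linter.unusedSectionVars false

variable {F : Type*} [NormedAddCommGroup F] [NormedSpace ℝ F]
  {H : Type*} [TopologicalSpace H] (I : ModelWithCorners ℝ F H)
  {S : Type*} [MetricSpace S] [ChartedSpace H S]

/-- The coordinates of a tangent vector in the chart at `x₀`. -/
def coord (x₀ θ : S) : TangentSpace I θ →ₗ[ℝ] F :=
  (mfderiv I 𝓘(ℝ, F) (extChartAt I x₀) θ : TangentSpace I θ →L[ℝ] F).toLinearMap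

/-- The tangent vector with given coordinates in the chart at `x₀`. -/
def uncoord (x₀ : S) (y : F) : F →ₗ[ℝ] TangentSpace I ((extChartAt I x₀).symm y) :=
  (mfderivWithin 𝓘(ℝ, F) I (extChartAt I x₀).symm (range I) y :
    F →L[ℝ] TangentSpace I ((extChartAt I x₀).symm y)).toLinearMap

variable [IsManifold I ∞ S]

lemma coord_uncoord {x₀ : S} {y : F} (hy : y ∈ (extChartAt I x₀).target) (a : F) :
    coord I x₀ _ (uncoord I x₀ y a) = a :=
  congr($(mfderiv_extChartAt_comp_mfderivWithin_extChartAt_symm (I := I) hy) a)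

lemma uncoord_coord {x₀ : S} {y : F} (hy : y ∈ (extChartAt I x₀).target)
    (ξ : TangentSpace I ((extChartAt I x₀).symm y)) :
    uncoord I x₀ y (coord I x₀ _ ξ) = ξ :=
  congr($(mfderivWithin_extChartAt_symm_comp_mfderiv_extChartAt (I := I) hy) ξ)

lemma exists_coord_eq {x₀ θ : S} (hθ : θ ∈ (extChartAt I x₀).source) (a : F) :
    ∃ ξ : TangentSpace I θ, coord I x₀ θ ξ = a := by
  obtain ⟨y, hy, rfl⟩ : ∃ y ∈ (extChartAt I x₀).target, (extChartAt I x₀).symm y = θ :=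
    ⟨_, (extChartAt I x₀).map_source hθ, (extChartAt I x₀).left_inv hθ⟩
  exact ⟨_, coord_uncoord I hy a⟩

/-- Velocities in the chart. -/
lemma coord_velocity {x₀ : S} {γ : ℝ → S} {t : ℝ}
    (hγ : MDifferentiableWithinAt 𝓘(ℝ, ℝ) I γ (Icc 0 1) t)
    (hs : γ t ∈ (extChartAt I x₀).source) :
    HasDerivWithinAt (fun s => extChartAt I x₀ (γ s)) (coord I x₀ _ (velocity I γ t))
      (Icc 0 1) t := by
  have h1 := (mdifferentiableAt_extChartAt (I := I) (x := x₀)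
    (by simpa using hs)).hasMFDerivAt.comp_hasMFDerivWithinAt t hγ.hasMFDerivWithinAt
  have h2 := hasMFDerivWithinAt_iff_hasFDerivWithinAt.1 h1
  have h3 : HasDerivWithinAt (fun s => extChartAt I x₀ (γ s)) _ (Icc (0 : ℝ) 1) t :=
    HasFDerivWithinAt.hasDerivWithinAt (F := F) h2
  exact h3

variable [RiemannianBundle (fun x : S => TangentSpace I x)]

/-- The chart metric evaluated on coordinates is the Riemannian inner product. -/
lemma chartMetric_coord {x₀ θ : S} (hθ : θ ∈ (extChartAt I x₀).source) (ξ ζ : TangentSpace I θ) :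
    chartMetric I x₀ (coord I x₀ θ ξ) (coord I x₀ θ ζ) (extChartAt I x₀ θ) = inner ℝ ξ ζ := by
  obtain ⟨y, hy, rfl⟩ : ∃ y ∈ (extChartAt I x₀).target, (extChartAt I x₀).symm y = θ :=
    ⟨_, (extChartAt I x₀).map_source hθ, (extChartAt I x₀).left_inv hθ⟩
  rw [(extChartAt I x₀).right_inv hy]
  have h1 := uncoord_coord I hy ξ
  have h2 := uncoord_coord I hy ζ
  exact congrArg₂ (inner ℝ) h1 h2

lemma chartMetric_add_left (x₀ : S) (a a' b y : F) :
    chartMetric I x₀ (a + a') b y = chartMetric I x₀ a b y + chartMetric I x₀ a' b y := by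
  have := (uncoord I x₀ y).map_add a a'
  change inner ℝ (uncoord I x₀ y (a + a')) (uncoord I x₀ y b) = _
  rw [this, inner_add_left]; rfl

lemma chartMetric_smul_left (x₀ : S) (c : ℝ) (a b y : F) :
    chartMetric I x₀ (c • a) b y = c * chartMetric I x₀ a b y := by
  have := (uncoord I x₀ y).map_smul c a
  change inner ℝ (uncoord I x₀ y (c • a)) (uncoord I x₀ y b) = _
  rw [this, real_inner_smul_left]; rfl

lemma chartMetric_comm (x₀ : S) (a b y : F) :
    chartMetric I x₀ a b y = chartMetric I x₀ b a y :=
  real_inner_comm _ _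

variable [IsContMDiffRiemannianBundle I ∞ F (fun x : S => TangentSpace I x)]

/-- The local comparison of fibre norms with coordinate norms needs only continuity of the metric,
which its smoothness provides. -/
instance : IsContinuousRiemannianBundle F (fun x : S => TangentSpace I x) := by
  obtain ⟨g, hg, h⟩ := IsContMDiffRiemannianBundle.exists_contMDiff (IB := I) (n := ∞) (F := F)
    (E := fun x : S => TangentSpace I x)
  exact ⟨g, hg.continuous, h⟩

/-- Riemannian norms and coordinate norms are locally uniformly comparable. -/
lemma exists_norm_coord_le (x₀ : S) :
    ∃ K > 0, ∀ᶠ θ in 𝓝 x₀, θ ∈ (extChartAt I x₀).source ∧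
      ∀ ξ : TangentSpace I θ, ‖coord I x₀ θ ξ‖ ≤ K * ‖ξ‖ ∧ ‖ξ‖ ≤ K * ‖coord I x₀ θ ξ‖ := by
  obtain ⟨C, hC, h⟩ := eventually_norm_trivializationAt_lt F (fun x : S => TangentSpace I x) x₀
  obtain ⟨C', hC', h'⟩ :=
    eventually_norm_symmL_trivializationAt_lt F (fun x : S => TangentSpace I x) x₀
  refine ⟨max C C', lt_max_of_lt_left hC, ?_⟩
  filter_upwards [h, h', extChartAt_source_mem_nhds (I := I) x₀] with θ h1 h2 h3
  refine ⟨h3, fun ξ => ?_⟩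
  have hs : θ ∈ (chartAt H x₀).source := by simpa using h3
  have e1 : coord I x₀ θ ξ =
      (trivializationAt F (TangentSpace I) x₀).continuousLinearMapAt ℝ θ ξ := by
    rw [TangentBundle.continuousLinearMapAt_trivializationAt hs]; rfl
  rw [e1]
  constructor
  · refine (ContinuousLinearMap.le_opNorm _ _).trans ?_
    gcongr
    exact h1.le.trans (le_max_left _ _)
  · have e2 : (trivializationAt F (TangentSpace I) x₀).symmL ℝ θ
        ((trivializationAt F (TangentSpace I) x₀).continuousLinearMapAt ℝ θ ξ) = ξ :=
      Trivialization.symmL_continuousLinearMapAt _ (by simpa using hs) _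
    conv_lhs => rw [← e2]
    refine (ContinuousLinearMap.le_opNorm _ _).trans ?_
    gcongr
    exact h2.le.trans (le_max_right _ _)

/-- The coefficients of the Riemannian tensor in a chart are smooth. -/
lemma contDiffOn_chartMetric (x₀ : S) (a b : F) :
    ContDiffOn ℝ 1 (chartMetric I x₀ a b) (extChartAt I x₀).target := by
  have key : ∀ a : F, ContMDiffOn 𝓘(ℝ, F) (I.prod 𝓘(ℝ, F)) 1
      (fun y => (⟨(extChartAt I x₀).symm y, uncoord I x₀ y a⟩ : TotalSpace F (TangentSpace I)))
      (extChartAt I x₀).target := by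
    intro a y hy
    have hsrc : (extChartAt I x₀).symm y ∈ (chartAt H x₀).source := by
      simpa using (extChartAt I x₀).map_target hy
    rw [(trivializationAt F (TangentSpace I) x₀).contMDiffWithinAt_iff (by simpa using hsrc)]
    refine ⟨((contMDiffOn_extChartAt_symm (n := 1) x₀) y hy), ?_⟩
    -- In the trivialization at `x₀` the fibre map is the derivative of the chart, so the coordinate
    -- field with coefficients `a` becomes constant.
    refine (contMDiffWithinAt_const (c := a)).congr_of_mem (fun z hz => ?_) hy
    have hz' : (extChartAt I x₀).symm z ∈ (chartAt H x₀).source := by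
      simpa using (extChartAt I x₀).map_target hz
    have h1 := coord_uncoord I hz a
    rw [← Trivialization.continuousLinearMapAt_apply_of_mem (R := ℝ) _ (by simpa using hz'),
      TangentBundle.continuousLinearMapAt_trivializationAt hz']
    exact h1
  rw [← contMDiffOn_iff_contDiffOn]
  have := ContMDiffOn.inner_bundle (IB := I) (n := 1) (E := fun x : S => TangentSpace I x)
    (key a) (key b)
  exact this

end Chart

/-- Coordinates with respect to a basis are bounded. -/
lemma exists_norm_repr_le {F : Type*} [NormedAddCommGroup F] [NormedSpace ℝ F]
    [FiniteDimensional ℝ F] {ι : Type*} [Fintype ι] (v : Module.Basis ι ℝ F) :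
    ∃ L > 0, ∀ i (a : F), |v.repr a i| ≤ L * ‖a‖ := by
  refine ⟨∑ i, ‖(v.coord i).toContinuousLinearMap‖ + 1, by positivity, fun i a => ?_⟩
  refine ((v.coord i).toContinuousLinearMap.le_opNorm a).trans ?_
  gcongr
  exact (Finset.single_le_sum (f := fun i => ‖(v.coord i).toContinuousLinearMap‖)
    (fun _ _ => norm_nonneg _) (Finset.mem_univ i)).trans (by linarith)

/-! ### Local bounds from the geodesic equation. -/

section Geodesic

set_option linter.unusedSectionVars false

variable {F : Type*} [NormedAddCommGroup F] [NormedSpace ℝ F]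
  {H : Type*} [TopologicalSpace H] (I : ModelWithCorners ℝ F H)
  {S : Type*} [MetricSpace S] [ChartedSpace H S] [IsManifold I ∞ S]
  [RiemannianBundle (fun x : S => TangentSpace I x)]
  [IsContMDiffRiemannianBundle I ∞ F (fun x : S => TangentSpace I x)]

lemma chartMetric_sum [FiniteDimensional ℝ F] {ι : Type*} [Fintype ι] (v : Module.Basis ι ℝ F)
    (x₀ : S) (a b y : F) :
    chartMetric I x₀ a b y =
      ∑ i, ∑ j, v.repr a i * v.repr b j * chartMetric I x₀ (v i) (v j) y := by
  have hl : ∀ (s : Finset ι) (c : ι → ℝ) (b : F), chartMetric I x₀ (∑ i ∈ s, c i • v i) b y =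
      ∑ i ∈ s, c i * chartMetric I x₀ (v i) b y := by
    intro s c b
    classical
    induction s using Finset.induction_on with
    | empty =>
      have := chartMetric_smul_left I x₀ 0 0 b y
      simpa using this
    | insert i s hi ih =>
      rw [Finset.sum_insert hi, Finset.sum_insert hi, chartMetric_add_left, chartMetric_smul_left,
        ih]
  conv_lhs => rw [← v.sum_repr a]
  rw [hl]
  refine Finset.sum_congr rfl fun i _ => ?_
  conv_lhs => rw [← v.sum_repr b]
  rw [chartMetric_comm, hl, Finset.mul_sum]
  refine Finset.sum_congr rfl fun j _ => ?_
  rw [chartMetric_comm]; ring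

/-- The first derivatives of the Riemannian tensor in a chart are locally bounded. -/
lemma exists_chartMetricDeriv_le [FiniteDimensional ℝ F] (x₀ : S) :
    ∃ K > 0, ∀ᶠ y in 𝓝[range I] (extChartAt I x₀ x₀), ∀ w a b : F,
      |chartMetricDeriv I x₀ w a b y| ≤ K * ‖w‖ * ‖a‖ * ‖b‖ := by
  -- By bilinearity it is enough to bound the derivatives of the finitely many coefficients `g (v i)
  -- (v j)`, which are continuous at the base point.
  let v := Module.finBasis ℝ F
  let g := fun i j => chartMetric I x₀ (v i) (v j)
  have hdiff : ∀ i j, ∀ y ∈ (extChartAt I x₀).target, ContDiffWithinAt ℝ 1 (g i j) (range I) y :=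
    fun i j y hy => (contDiffOn_chartMetric I x₀ (v i) (v j) y hy).mono_of_mem_nhdsWithin
      (extChartAt_target_mem_nhdsWithin_of_mem hy)
  have hbd : ∀ i j, ∃ K > 0, ∀ᶠ y in 𝓝[range I] (extChartAt I x₀ x₀),
      ‖fderivWithin ℝ (g i j) (range I) y‖ ≤ K := by
    intro i j
    have h1 : ContinuousWithinAt (fderivWithin ℝ (g i j) (range I)) (range I)
        (extChartAt I x₀ x₀) :=
      ((hdiff i j _ (mem_extChartAt_target x₀)).fderivWithin_right (m := 0) I.uniqueDiffOn
        (by norm_num) (extChartAt_target_subset_range x₀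
          (mem_extChartAt_target x₀))).continuousWithinAt
    refine ⟨‖fderivWithin ℝ (g i j) (range I) (extChartAt I x₀ x₀)‖ + 1, by positivity, ?_⟩
    filter_upwards [h1.norm.eventually (gt_mem_nhds (lt_add_one _))] with y hy using hy.le
  choose K hK0 hK using hbd
  obtain ⟨L, hL0, hL⟩ := exists_norm_repr_le v
  refine ⟨(∑ i, ∑ j, L * L * K i j) + 1, add_pos_of_nonneg_of_pos (Finset.sum_nonneg fun i _ =>
    Finset.sum_nonneg fun j _ => by have := hK0 i j; positivity) one_pos, ?_⟩
  have hall : ∀ᶠ y in 𝓝[range I] (extChartAt I x₀ x₀), ∀ i j,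
      ‖fderivWithin ℝ (g i j) (range I) y‖ ≤ K i j :=
    eventually_all.2 fun i => eventually_all.2 fun j => hK i j
  filter_upwards [hall, extChartAt_target_mem_nhdsWithin x₀] with y hy hyt w a b
  have hfd : HasFDerivWithinAt (chartMetric I x₀ a b)
      (∑ i, ∑ j, (v.repr a i * v.repr b j) • fderivWithin ℝ (g i j) (range I) y) (range I) y := by
    have h0 : chartMetric I x₀ a b =
        fun y => ∑ i, ∑ j, (v.repr a i * v.repr b j) * g i j y := by
      ext y; exact chartMetric_sum I v x₀ a b y
    rw [h0]
    refine HasFDerivWithinAt.fun_sum fun i _ => HasFDerivWithinAt.fun_sum fun j _ => ?_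
    exact ((hdiff i j y hyt).differentiableWithinAt one_ne_zero).hasFDerivWithinAt.const_mul _
  have hyr := extChartAt_target_subset_range x₀ hyt
  rw [chartMetricDeriv, hfd.fderivWithin (I.uniqueDiffOn y hyr)]
  rw [← Real.norm_eq_abs]
  simp only [_root_.sum_apply, _root_.smul_apply, smul_eq_mul]
  have : ∀ i j, ‖v.repr a i * v.repr b j * fderivWithin ℝ (g i j) (range I) y w‖ ≤
      L * L * K i j * (‖w‖ * ‖a‖ * ‖b‖) := by
    intro i j
    rw [norm_mul, norm_mul, Real.norm_eq_abs, Real.norm_eq_abs]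
    have h1 := hL i a
    have h2 := hL j b
    have h3 : ‖fderivWithin ℝ (g i j) (range I) y w‖ ≤ K i j * ‖w‖ :=
      (ContinuousLinearMap.le_opNorm _ _).trans (by gcongr; exact hy i j)
    calc _ ≤ (L * ‖a‖) * (L * ‖b‖) * (K i j * ‖w‖) := by gcongr
      _ = _ := by ring
  calc _ ≤ ∑ i, ∑ j, L * L * K i j * (‖w‖ * ‖a‖ * ‖b‖) :=
        (norm_sum_le _ _).trans (Finset.sum_le_sum fun i _ =>
          (norm_sum_le _ _).trans (Finset.sum_le_sum fun j _ => this i j))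
    _ = (∑ i, ∑ j, L * L * K i j) * (‖w‖ * ‖a‖ * ‖b‖) := by
        simp_rw [Finset.sum_mul]
    _ ≤ ((∑ i, ∑ j, L * L * K i j) + 1) * (‖w‖ * ‖a‖ * ‖b‖) := by
        gcongr; linarith
    _ = _ := by ring

/-- In a chart, the acceleration of a geodesic is locally bounded by the square of its speed. -/
lemma exists_geodesic_accel_le [FiniteDimensional ℝ F] (x₀ : S) :
    ∃ K > 0, ∀ᶠ θ in 𝓝 x₀, ∀ γ : ℝ → S, IsGeodesic I γ → ∀ t ∈ Icc (0 : ℝ) 1, γ t = θ →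
      ‖derivWithin (derivWithin (fun s => extChartAt I x₀ (γ s)) (Icc 0 1)) (Icc 0 1) t‖ ≤
        K * ‖derivWithin (fun s => extChartAt I x₀ (γ s)) (Icc 0 1) t‖ ^ 2 := by
  obtain ⟨K, hK0, hK⟩ := exists_chartMetricDeriv_le I x₀
  obtain ⟨N, hN0, hN⟩ := exists_norm_coord_le I x₀
  refine ⟨2 * K * N ^ 2, by positivity, ?_⟩
  have hK' : ∀ᶠ θ in 𝓝 x₀, ∀ w a b : F,
      |chartMetricDeriv I x₀ w a b (extChartAt I x₀ θ)| ≤ K * ‖w‖ * ‖a‖ * ‖b‖ := by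
    have h1 : Tendsto (extChartAt I x₀) (𝓝 x₀) (𝓝[range I] (extChartAt I x₀ x₀)) :=
      tendsto_nhdsWithin_iff.2 ⟨continuousAt_extChartAt x₀, by
        filter_upwards [extChartAt_source_mem_nhds (I := I) x₀] with θ hθ
        exact extChartAt_target_subset_range x₀ ((extChartAt I x₀).map_source hθ)⟩
    exact h1.eventually hK
  filter_upwards [hK', hN] with θ h1 ⟨hs, h2⟩ γ hγ t ht hθ
  subst hθ
  have hgeo := hγ.2 x₀ t ht (by simpa using hs)
  dsimp only at hgeo
  set u' := derivWithin (fun s => extChartAt I x₀ (γ s)) (Icc 0 1) t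
  set u'' := derivWithin (derivWithin (fun s => extChartAt I x₀ (γ s)) (Icc 0 1)) (Icc 0 1) t
  -- Testing with `w = u''` turns the leading term into `g(u'', u'')`, which dominates `‖u''‖² /
  -- N²`. The other two terms are at most `(3/2) K ‖u'‖² ‖u''‖`, and one factor `‖u''‖` cancels.
  have h3 := hgeo u''
  have h4 : ‖u''‖ ^ 2 ≤ N ^ 2 * chartMetric I x₀ u'' u'' (extChartAt I x₀ (γ t)) := by
    obtain ⟨ξ, hξ⟩ := exists_coord_eq I hs u''
    rw [← hξ, chartMetric_coord I hs, real_inner_self_eq_norm_sq, ← mul_pow]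
    have := (h2 ξ).1
    gcongr
  have h5 := abs_le.1 (h1 u' u' u'')
  have h6 := abs_le.1 (h1 u'' u' u')
  have h7 : ‖u''‖ ^ 2 ≤ N ^ 2 * (2 * K * ‖u'‖ ^ 2 * ‖u''‖) := by
    refine h4.trans ?_
    gcongr
    have : 0 ≤ K * ‖u'‖ ^ 2 * ‖u''‖ := by positivity
    nlinarith
  by_cases h0 : ‖u''‖ = 0
  · rw [h0]; positivity
  · have h8 : 0 < ‖u''‖ := lt_of_le_of_ne (norm_nonneg _) (Ne.symm h0)
    refine le_of_mul_le_mul_right ?_ h8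
    nlinarith

/-- A `C¹` curve with speed at most `c` is `c`-Lipschitz. -/
lemma dist_le_of_norm_velocity_le [IsRiemannianManifold I S] {γ : ℝ → S} {c : ℝ}
    (hγ : ContMDiffOn 𝓘(ℝ, ℝ) I 1 γ (Icc 0 1))
    (hv : ∀ t ∈ Icc (0 : ℝ) 1, ‖velocity I γ t‖ ≤ c) {s t : ℝ} (hs : 0 ≤ s) (hst : s ≤ t)
    (ht : t ≤ 1) : dist (γ s) (γ t) ≤ c * (t - s) := by
  have hc : 0 ≤ c := (norm_nonneg _).trans (hv 0 (by simp))
  have h1 : edist (γ s) (γ t) ≤ ENNReal.ofReal c * ENNReal.ofReal (t - s) := by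
    rw [IsRiemannianManifold.out (I := I) (γ s) (γ t)]
    refine (Manifold.riemannianEDist_le_pathELength (I := I)
      (hγ.mono (Icc_subset_Icc hs ht)) rfl rfl hst).trans ?_
    rw [Manifold.pathELength_eq_lintegral_mfderiv_Ioo]
    refine (setLIntegral_mono' measurableSet_Ioo (g := fun _ => ENNReal.ofReal c)
      fun r hr => ?_).trans ?_
    · have hr' : r ∈ Icc (0 : ℝ) 1 := ⟨hs.trans hr.1.le, hr.2.le.trans ht⟩
      have := hv r hr'
      rw [velocity, mfderivWithin_of_mem_nhds (Icc_mem_nhds (hs.trans_lt hr.1)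
        (hr.2.trans_le ht))] at this
      rw [← ofReal_norm]
      exact ENNReal.ofReal_le_ofReal this
    · rw [setLIntegral_const, Real.volume_Ioo]
  rw [edist_dist, ← ENNReal.ofReal_mul hc] at h1
  exact (ENNReal.ofReal_le_ofReal_iff (mul_nonneg hc (by linarith))).1 h1

end Geodesic

/-! ### Second order estimates for logarithms in a chart. -/

section Log

set_option linter.unusedSectionVars false

variable {F : Type*} [NormedAddCommGroup F] [NormedSpace ℝ F]
  {H : Type*} [TopologicalSpace H] {I : ModelWithCorners ℝ F H}
  {S : Type*} [MetricSpace S] [ChartedSpace H S] [IsManifold I ∞ S]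
  [RiemannianBundle (fun x : S => TangentSpace I x)]

lemma Model.isGeodesicFrom_expCurve {d : ℕ} {Ω : Set (V d)} (M : Model I S Ω) {θ : S}
    {η : TangentSpace I θ} (hη : η ∈ M.D θ) : IsGeodesicFrom I θ η (expCurve I θ η) := by
  have h := M.exp_defined θ η hη
  rw [expCurve, dif_pos h]
  exact h.choose_spec

lemma IsGeodesicFrom.zero {θ : S} {η : TangentSpace I θ} {γ : ℝ → S}
    (h : IsGeodesicFrom I θ η γ) : γ 0 = θ :=
  congrArg (fun p : TangentBundle I S => p.1) h.2

/-- The points `γ 0` and `θ` are only propositionally equal, so the initial velocity is compared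
with `η` through the total space of the tangent bundle. -/
lemma IsGeodesicFrom.coord_zero {θ : S} {η : TangentSpace I θ} {γ : ℝ → S}
    (h : IsGeodesicFrom I θ η γ) (x₀ : S) :
    coord I x₀ _ (velocity I γ 0) = coord I x₀ θ η :=
  congrArg (fun p : TangentBundle I S => coord I x₀ p.1 p.2) h.2

variable [IsContMDiffRiemannianBundle I ∞ F (fun x : S => TangentSpace I x)]
  [IsRiemannianManifold I S] [FiniteDimensional ℝ F]

lemma Model.dist_expCurve_le {d : ℕ} {Ω : Set (V d)} (M : Model I S Ω) {θ : S}
    {η : TangentSpace I θ} (hη : η ∈ M.D θ) {s t : ℝ} (hs : 0 ≤ s) (hst : s ≤ t) (ht : t ≤ 1) :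
    dist (expCurve I θ η s) (expCurve I θ η t) ≤ ‖η‖ * (t - s) :=
  dist_le_of_norm_velocity_le I ((M.isGeodesicFrom_expCurve hη).1.1.of_le (by norm_num))
    (fun t ht => (M.D_speed θ η hη t ht).le) hs hst ht

variable (I) in
/-- The inverse of a chart is locally Lipschitz. -/
lemma exists_dist_le_chart (x₀ : S) :
    ∃ K > 0, ∃ U ∈ 𝓝 x₀, ∀ θ ∈ U, ∀ θ' ∈ U,
      dist θ θ' ≤ K * ‖extChartAt I x₀ θ - extChartAt I x₀ θ'‖ := by
  obtain ⟨K, hK0, hK⟩ := exists_norm_coord_le I x₀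
  have hpre : ∀ᶠ y in 𝓝[range I] (extChartAt I x₀ x₀), y ∈ (extChartAt I x₀).target ∧
      ∀ a, ‖uncoord I x₀ y a‖ ≤ K * ‖a‖ := by
    have h1 : Tendsto (extChartAt I x₀).symm (𝓝[range I] (extChartAt I x₀ x₀)) (𝓝 x₀) := by
      have := (continuousAt_extChartAt_symm (I := I) x₀).tendsto
      rw [extChartAt_to_inv] at this
      exact this.mono_left nhdsWithin_le_nhds
    filter_upwards [h1.eventually hK, extChartAt_target_mem_nhdsWithin x₀] with y hy hyt
    refine ⟨hyt, fun a => ?_⟩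
    have := (hy.2 (uncoord I x₀ y a)).2
    rwa [coord_uncoord I hyt] at this
  obtain ⟨r, r_pos, hr⟩ := Metric.mem_nhdsWithin_iff.1 hpre
  refine ⟨K, hK0, (extChartAt I x₀).source ∩
    (extChartAt I x₀) ⁻¹' (Metric.ball (extChartAt I x₀ x₀) r),
    inter_mem (extChartAt_source_mem_nhds x₀)
      ((continuousAt_extChartAt x₀).preimage_mem_nhds (Metric.ball_mem_nhds _ r_pos)), ?_⟩
  rintro θ ⟨hθs, hθ⟩ θ' ⟨hθs', hθ'⟩
  have hrange : ∀ {z : S}, z ∈ (extChartAt I x₀).source → extChartAt I x₀ z ∈ range I := fun h =>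
    extChartAt_target_subset_range x₀ ((extChartAt I x₀).map_source h)
  let y := extChartAt I x₀ θ
  let y' := extChartAt I x₀ θ'
  -- The coordinate segment stays in the model range because that range is convex, also at the
  -- boundary. Its image in `S` bounds the distance.
  let l : ℝ → F := fun t => y + t • (y' - y)
  have hl : ∀ t ∈ Icc (0 : ℝ) 1, l t ∈ Metric.ball (extChartAt I x₀ x₀) r ∩ range I := fun t ht =>
    ((convex_ball _ _).inter I.convex_range).add_smul_sub_mem ⟨hθ, hrange hθs⟩
      ⟨hθ', hrange hθs'⟩ ht
  have hlC : ContDiff ℝ 1 l := by fun_prop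
  have hld : ∀ t, HasDerivAt l (y' - y) t := fun t => by
    have := ((hasDerivAt_id t).smul_const (y' - y)).const_add y
    rwa [one_smul] at this
  let γ : ℝ → S := fun t => (extChartAt I x₀).symm (l t)
  have hγ : ContMDiffOn 𝓘(ℝ, ℝ) I 1 γ (Icc 0 1) :=
    (contMDiffOn_extChartAt_symm (n := 1) x₀).comp hlC.contMDiff.contMDiffOn
      fun t ht => (hr (hl t ht)).1
  have hv : ∀ t ∈ Icc (0 : ℝ) 1, ‖velocity I γ t‖ ≤ K * ‖y - y'‖ := by
    intro t ht
    have h1 := (mdifferentiableWithinAt_extChartAt_symm (hr (hl t ht)).1).hasMFDerivWithinAt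
    have h2 : HasMFDerivWithinAt 𝓘(ℝ, ℝ) 𝓘(ℝ, F) l (Icc 0 1) t
        (ContinuousLinearMap.toSpanSingleton ℝ (y' - y)) :=
      (hld t).hasFDerivAt.hasFDerivWithinAt.hasMFDerivWithinAt
    have h3 := h1.comp t h2 (fun t ht => (hl t ht).2)
    have h4 : velocity I γ t = uncoord I x₀ (l t) (y' - y) := by
      rw [velocity]
      have h5 : mfderivWithin 𝓘(ℝ, ℝ) I γ (Icc 0 1) t = _ :=
        h3.mfderivWithin (uniqueMDiffWithinAt_iff_uniqueDiffWithinAt.2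
          (uniqueDiffOn_Icc zero_lt_one t ht))
      rw [h5]
      change uncoord I x₀ (l t) ((1 : ℝ) • (y' - y)) = _
      rw [one_smul]
    rw [h4, ← norm_neg (y - y'), neg_sub]
    exact (hr (hl t ht)).2 _
  have := dist_le_of_norm_velocity_le I hγ hv le_rfl zero_le_one le_rfl
  have e0 : γ 0 = θ := by
    simpa only [γ, l, y, zero_smul, add_zero] using (extChartAt I x₀).left_inv hθs
  have e1 : γ 1 = θ' := by
    simpa only [γ, l, y, y', one_smul, add_sub_cancel] using (extChartAt I x₀).left_inv hθs'
  rwa [e0, e1, sub_zero, mul_one] at this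

/-- Second order estimates in a chart for the geodesics produced by the exponential map. -/
lemma Model.exists_log_estimates {d : ℕ} {Ω : Set (V d)} (M : Model I S Ω) (x₀ : S) :
    ∃ K > 0, ∃ U ∈ 𝓝 x₀, U ⊆ (extChartAt I x₀).source ∧
      (∀ θ ∈ U, ∀ ξ : TangentSpace I θ,
        ‖coord I x₀ θ ξ‖ ≤ K * ‖ξ‖ ∧ ‖ξ‖ ≤ K * ‖coord I x₀ θ ξ‖) ∧
      ∀ θ ∈ U, ∀ η ∈ M.D θ, expCurve I θ η 1 ∈ U →
        ‖extChartAt I x₀ (expCurve I θ η 1) - extChartAt I x₀ θ‖ ≤ K * ‖η‖ ∧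
        ‖extChartAt I x₀ (expCurve I θ η 1) - extChartAt I x₀ θ - coord I x₀ θ η‖ ≤
          K * ‖η‖ ^ 2 ∧
        ‖coord I x₀ _ (velocity I (expCurve I θ η) 1) - coord I x₀ θ η‖ ≤ K * ‖η‖ ^ 2 := by
  obtain ⟨K₁, hK₁, h₁⟩ := exists_norm_coord_le I x₀
  obtain ⟨K₂, hK₂, h₂⟩ := exists_geodesic_accel_le I x₀
  obtain ⟨r, hr, hball⟩ := Metric.eventually_nhds_iff_ball.1 (h₁.and h₂)
  -- Two points of the ball of radius `r / 3` are joined by a minimizing geodesic of length below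
  -- `2r / 3`, so the whole geodesic stays in the ball of radius `r`, where the local bounds hold.
  have hsub : Metric.ball x₀ (r / 3) ⊆ Metric.ball x₀ r := Metric.ball_subset_ball (by linarith)
  let K := max K₁ (K₂ * K₁ ^ 2)
  have hKK : K₁ ≤ K := le_max_left _ _
  refine ⟨K, lt_max_of_lt_left hK₁, Metric.ball x₀ (r / 3),
    Metric.ball_mem_nhds _ (by positivity), fun θ hθ => (hball θ (hsub hθ)).1.1,
    fun θ hθ ξ => ?_, fun θ hθ η hη hθ' => ?_⟩
  · have := (hball θ (hsub hθ)).1.2 ξ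
    exact ⟨this.1.trans (by gcongr), this.2.trans (by gcongr)⟩
  have hg := M.isGeodesicFrom_expCurve hη
  have hdist : ‖η‖ < 2 * r / 3 := by
    rw [M.D_dist θ η hη]
    have h1 := Metric.mem_ball.1 hθ
    have h2 := Metric.mem_ball.1 hθ'
    have := dist_triangle_right θ (expCurve I θ η 1) x₀
    linarith
  have hstay : ∀ t ∈ Icc (0 : ℝ) 1, expCurve I θ η t ∈ Metric.ball x₀ r := by
    intro t ht
    have h1 := M.dist_expCurve_le hη le_rfl ht.1 ht.2
    rw [hg.zero, sub_zero] at h1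
    have h2 := Metric.mem_ball.1 hθ
    have h3 : ‖η‖ * t ≤ ‖η‖ := mul_le_of_le_one_right (norm_nonneg _) ht.2
    have := dist_triangle_left (expCurve I θ η t) x₀ θ
    rw [Metric.mem_ball]
    linarith
  have hspeed := M.D_speed θ η hη
  have hz := hg.zero
  have hcz := hg.coord_zero x₀
  set γ := expCurve I θ η with hγdef
  let u : ℝ → F := fun s => extChartAt I x₀ (γ s)
  have hu2 : ContDiffOn ℝ 2 u (Icc 0 1) := by
    rw [← contMDiffOn_iff_contDiffOn]
    exact (contMDiffOn_extChartAt (n := 2) (x := x₀)).comp hg.1.1 fun t ht => by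
      simpa using (hball _ (hstay t ht)).1.1
  have hmd : MDifferentiableOn 𝓘(ℝ, ℝ) I γ (Icc 0 1) := hg.1.1.mdifferentiableOn (by norm_num)
  have hu : ∀ t ∈ Icc (0 : ℝ) 1,
      derivWithin u (Icc 0 1) t = coord I x₀ _ (velocity I γ t) := fun t ht =>
    (coord_velocity I (hmd t ht) (hball _ (hstay t ht)).1.1).derivWithin
      (uniqueDiffOn_Icc zero_lt_one t ht)
  have hu' : ∀ t ∈ Icc (0 : ℝ) 1, ‖derivWithin u (Icc 0 1) t‖ ≤ K₁ * ‖η‖ := fun t ht => by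
    rw [hu t ht, ← hspeed t ht]
    exact ((hball _ (hstay t ht)).1.2 _).1
  have hu'' : ∀ t ∈ Icc (0 : ℝ) 1, ‖derivWithin (derivWithin u (Icc 0 1)) (Icc 0 1) t‖ ≤
      K₂ * K₁ ^ 2 * ‖η‖ ^ 2 := fun t ht => by
    refine ((hball _ (hstay t ht)).2 γ hg.1 t ht rfl).trans ?_
    rw [mul_assoc, ← mul_pow]
    have := hu' t ht
    gcongr
  have hd1 : DifferentiableOn ℝ u (Icc 0 1) := hu2.differentiableOn (by norm_num)
  have hd2 : DifferentiableOn ℝ (derivWithin u (Icc 0 1)) (Icc 0 1) :=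
    (hu2.derivWithin (uniqueDiffOn_Icc zero_lt_one) (m := 1) (by norm_num)).differentiableOn
      (by norm_num)
  have h0 : (0 : ℝ) ∈ Icc (0 : ℝ) 1 := by simp
  have h1 : (1 : ℝ) ∈ Icc (0 : ℝ) 1 := by simp
  have e1 : ∀ t ∈ Icc (0 : ℝ) 1, ‖derivWithin u (Icc 0 1) t - coord I x₀ θ η‖ ≤
      K₂ * K₁ ^ 2 * ‖η‖ ^ 2 := by
    intro t ht
    have := (convex_Icc (0 : ℝ) 1).norm_image_sub_le_of_norm_derivWithin_le hd2 hu'' h0 ht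
    rw [hu 0 h0, hcz] at this
    refine this.trans (mul_le_of_le_one_right (by positivity) ?_)
    rw [sub_zero, Real.norm_eq_abs, abs_of_nonneg ht.1]
    exact ht.2
  have hKη : K₂ * K₁ ^ 2 * ‖η‖ ^ 2 ≤ K * ‖η‖ ^ 2 := by
    gcongr; exact le_max_right _ _
  refine ⟨?_, ?_, ?_⟩
  · have := (convex_Icc (0 : ℝ) 1).norm_image_sub_le_of_norm_derivWithin_le hd1 hu' h0 h1
    simp only [u, hz, sub_zero, norm_one, mul_one] at this
    exact this.trans (by gcongr)
  -- After subtracting the linear path with the initial velocity, the derivative that remains is the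
  -- change of velocity, already of order `‖η‖²`.
  · have hw : ∀ t ∈ Icc (0 : ℝ) 1, HasDerivWithinAt (fun t => u t - t • coord I x₀ θ η)
        (derivWithin u (Icc 0 1) t - coord I x₀ θ η) (Icc 0 1) t := fun t ht => by
      have := (hd1 t ht).hasDerivWithinAt.sub
        ((hasDerivWithinAt_id t (Icc (0 : ℝ) 1)).smul_const (coord I x₀ θ η))
      rwa [one_smul] at this
    have := (convex_Icc (0 : ℝ) 1).norm_image_sub_le_of_norm_hasDerivWithin_le hw e1 h0 h1
    simp only [u, hz, one_smul, zero_smul, sub_zero, norm_one, mul_one] at this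
    refine le_trans (le_of_eq ?_) (this.trans hKη)
    congr 1; abel
  · have := (e1 1 h1).trans hKη
    rwa [hu 1 h1] at this

end Log

/-! ### Local boundedness of linear maps controlled only on `𝒟`. -/

/-- A linear map that is bounded on a small perturbation of a basis is bounded. -/
lemma norm_le_of_near_basis {T F W : Type*} [AddCommGroup T] [Module ℝ T]
    [NormedAddCommGroup F] [NormedSpace ℝ F] [NormedAddCommGroup W] [NormedSpace ℝ W]
    {ι : Type*} [Fintype ι] (v : Module.Basis ι ℝ F) (c : T →ₗ[ℝ] F)
    (hc : Function.Bijective c) (l : T →ₗ[ℝ] W) {L δ B : ℝ} (hL0 : 0 < L)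
    (hL : ∀ i (a : F), |v.repr a i| ≤ L * ‖a‖) (hδ : Fintype.card ι * (L * δ) ≤ 1 / 2)
    {κ : ι → T} (hκ : ∀ i, ‖v i - c (κ i)‖ ≤ δ) (hB : ∀ i, ‖l (κ i)‖ ≤ B) (ξ : T) :
    ‖l ξ‖ ≤ L * (2 * Fintype.card ι * B) * ‖c ξ‖ := by
  choose β hβ using fun i => hc.2 (v i)
  have hexp : ∀ ξ : T, ξ = ∑ i, v.repr (c ξ) i • β i := fun ξ => hc.1 <| by
    simp only [map_sum, map_smul, hβ]
    exact (v.sum_repr (c ξ)).symm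
  have hl : ∀ ξ : T, ‖l ξ‖ ≤ L * ‖c ξ‖ * ∑ i, ‖l (β i)‖ := fun ξ => by
    conv_lhs => rw [hexp ξ]
    rw [map_sum, Finset.mul_sum]
    refine (norm_sum_le _ _).trans (Finset.sum_le_sum fun i _ => ?_)
    rw [map_smul, norm_smul]
    gcongr
    exact hL i _
  -- The vector `β i - κ i` has coordinates of norm at most `δ`, so its image is bounded by a small
  -- multiple of `∑ ‖l (β i)‖`. That sum is finite, so `hδ` lets it be absorbed on the left after
  -- summation.
  have h1 : ∀ i, ‖l (β i)‖ ≤ B + L * δ * ∑ i, ‖l (β i)‖ := fun i => by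
    have h2 := hl (β i - κ i)
    rw [map_sub, map_sub, hβ] at h2
    have h3 : ‖l (β i)‖ ≤ ‖l (κ i)‖ + ‖l (β i) - l (κ i)‖ := norm_le_insert' _ _
    have h4 : L * ‖v i - c (κ i)‖ * ∑ i, ‖l (β i)‖ ≤ L * δ * ∑ i, ‖l (β i)‖ := by
      gcongr
      exact hκ i
    linarith [hB i]
  have h2 : ∑ i, ‖l (β i)‖ ≤ Fintype.card ι * (B + L * δ * ∑ i, ‖l (β i)‖) := by
    refine (Finset.sum_le_sum fun i _ => h1 i).trans ?_
    rw [Finset.sum_const, nsmul_eq_mul, Finset.card_univ]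
  have h3 : ∑ i, ‖l (β i)‖ ≤ 2 * Fintype.card ι * B := by
    have : 0 ≤ ∑ i, ‖l (β i)‖ := by positivity
    nlinarith
  refine (hl ξ).trans ?_
  calc _ ≤ L * ‖c ξ‖ * (2 * Fintype.card ι * B) := by gcongr
    _ = _ := by ring

section Uniform

set_option linter.unusedSectionVars false

variable {F : Type*} [NormedAddCommGroup F] [NormedSpace ℝ F]
  {H : Type*} [TopologicalSpace H] {I : ModelWithCorners ℝ F H}
  {S : Type*} [MetricSpace S] [ChartedSpace H S] [IsManifold I ∞ S]
  [RiemannianBundle (fun x : S => TangentSpace I x)]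
  [IsContMDiffRiemannianBundle I ∞ F (fun x : S => TangentSpace I x)]
  [IsRiemannianManifold I S] [FiniteDimensional ℝ F]

lemma coord_bijective {x₀ θ : S} (hθ : θ ∈ (extChartAt I x₀).source) :
    Function.Bijective (coord I x₀ θ) := by
  refine ⟨?_, exists_coord_eq I hθ⟩
  obtain ⟨y, hy, rfl⟩ : ∃ y ∈ (extChartAt I x₀).target, (extChartAt I x₀).symm y = θ :=
    ⟨_, (extChartAt I x₀).map_source hθ, (extChartAt I x₀).left_inv hθ⟩
  exact Function.LeftInverse.injective (uncoord_coord I hy)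

/-- Near each point there are minimizing geodesics, with uniform estimates, towards finitely
many prescribed points of the chart's range. -/
lemma Model.exists_log_toward {d : ℕ} {Ω : Set (V d)} (M : Model I S Ω) (x₀ : S) {R : ℝ}
    (hR : 0 < R) :
    ∃ K > 0, ∃ s₀ > 0, ∀ s ∈ Ioc 0 s₀, ∀ᶠ θ in 𝓝 x₀, θ ∈ (extChartAt I x₀).source ∧
      ∀ q ∈ range I, ‖q - extChartAt I x₀ θ‖ ≤ R → ∃ η ∈ M.D θ, ‖η‖ ≤ K * s ∧
        ‖s • (q - extChartAt I x₀ θ) - coord I x₀ θ η‖ ≤ K * s ^ 2 := by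
  obtain ⟨K₁, hK₁, U₁, hU₁, hsrc, -, hlog⟩ := M.exists_log_estimates x₀
  obtain ⟨K₂, hK₂, U₂, hU₂, hdist⟩ := exists_dist_le_chart I x₀
  have h1 : ∀ᶠ y in 𝓝[range I] (extChartAt I x₀ x₀), y ∈ (extChartAt I x₀).target ∧
      (extChartAt I x₀).symm y ∈ U₁ ∩ U₂ := by
    have h1 := (continuousAt_extChartAt_symm (I := I) x₀).tendsto
    rw [extChartAt_to_inv] at h1
    filter_upwards [(h1.mono_left nhdsWithin_le_nhds).eventually (inter_mem hU₁ hU₂),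
      extChartAt_target_mem_nhdsWithin x₀] with y hy hyt using ⟨hyt, hy⟩
  obtain ⟨ρ, hρ, hball⟩ := Metric.mem_nhdsWithin_iff.1 h1
  -- The first constant bounds `‖η‖ / s` by the Lipschitz estimate for the inverse chart. The second
  -- inserts this bound into the quadratic error of the logarithm. The bound on `s` keeps the target
  -- point in the ball of radius `ρ`.
  refine ⟨max (K₂ * R) (K₁ * (K₂ * R) ^ 2), lt_max_of_lt_left (by positivity),
    min 1 (ρ / (2 * (R + 1))), lt_min one_pos (by positivity), fun s hs => ?_⟩
  have hs1 : s ≤ 1 := hs.2.trans (min_le_left _ _)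
  have hs2 : s * R < ρ / 2 := by
    have h2 : s ≤ ρ / (2 * (R + 1)) := hs.2.trans (min_le_right _ _)
    rw [le_div_iff₀ (by positivity)] at h2
    nlinarith [hs.1]
  filter_upwards [hU₁, hU₂, (continuousAt_extChartAt (I := I) x₀).preimage_mem_nhds
    (Metric.ball_mem_nhds _ (half_pos hρ))] with θ hθ₁ hθ₂ hθ
  refine ⟨hsrc hθ₁, fun q hq hqR => ?_⟩
  have hθt := (extChartAt I x₀).map_source (hsrc hθ₁)
  set y := extChartAt I x₀ θ with hy
  have hnorm : ‖s • (q - y)‖ ≤ s * R := by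
    rw [norm_smul, Real.norm_of_nonneg hs.1.le]
    exact mul_le_mul_of_nonneg_left hqR hs.1.le
  -- Convexity of `range I` makes the move from `y` towards `q` admissible even when `θ` is a
  -- boundary point.
  have hz : y + s • (q - y) ∈ Metric.ball (extChartAt I x₀ x₀) ρ ∩ range I := by
    refine ⟨?_, I.convex_range.add_smul_sub_mem (extChartAt_target_subset_range x₀ hθt) hq
      ⟨hs.1.le, hs1⟩⟩
    have h3 : dist y (extChartAt I x₀ x₀) < ρ / 2 := hθ
    rw [Metric.mem_ball, dist_eq_norm] at *
    calc ‖y + s • (q - y) - extChartAt I x₀ x₀‖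
        = ‖(y - extChartAt I x₀ x₀) + s • (q - y)‖ := by congr 1; abel
      _ ≤ _ := norm_add_le _ _
      _ < ρ := by linarith
  obtain ⟨hzt, hz₁, hz₂⟩ := hball hz
  obtain ⟨η, hη, hexp⟩ := M.D_joins θ ((extChartAt I x₀).symm (y + s • (q - y)))
  have he : extChartAt I x₀ (expCurve I θ η 1) = y + s • (q - y) := by
    rw [hexp, (extChartAt I x₀).right_inv hzt]
  have hηn : ‖η‖ ≤ K₂ * R * s := by
    have h4 := hdist θ hθ₂ _ hz₂
    rw [← hexp, ← M.D_dist θ η hη, he, norm_sub_rev, ← hy, add_sub_cancel_left] at h4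
    refine h4.trans ?_
    calc K₂ * ‖s • (q - y)‖ ≤ K₂ * (s * R) := by gcongr
      _ = _ := by ring
  refine ⟨η, hη, hηn.trans (by have := hs.1; gcongr; exact le_max_left _ _), ?_⟩
  have h5 := (hlog θ hθ₁ η hη (hexp ▸ hz₁)).2.1
  rw [he, ← hy, add_sub_cancel_left] at h5
  refine h5.trans ?_
  calc K₁ * ‖η‖ ^ 2 ≤ K₁ * (K₂ * R * s) ^ 2 := by gcongr
    _ = K₁ * (K₂ * R) ^ 2 * s ^ 2 := by ring
    _ ≤ _ := by gcongr; exact le_max_right _ _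

/-- A linear map on `T_θ S` that is bounded on `𝒟_θ` is bounded, locally uniformly in `θ`. -/
lemma Model.exists_norm_le_of_bounded_on_D {d : ℕ} {Ω : Set (V d)} (M : Model I S Ω) (x₀ : S)
    (W : Type*) [NormedAddCommGroup W] [NormedSpace ℝ W] :
    ∃ K > 0, ∀ᶠ θ in 𝓝 x₀, ∀ C : ℝ, 0 ≤ C → ∀ l : TangentSpace I θ →ₗ[ℝ] W,
      (∀ η ∈ M.D θ, ‖l η‖ ≤ C * ‖η‖) → ∀ ξ, ‖l ξ‖ ≤ K * C * ‖coord I x₀ θ ξ‖ := by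
  let v := Module.finBasis ℝ F
  obtain ⟨L, hL0, hL⟩ := exists_norm_repr_le v
  -- At the boundary the directions of logarithms may fill only a cone. The directions towards `p +
  -- r • v i` and towards an interior point `p` differ by `r • v i`, so differences of logarithms
  -- approximate a basis.
  obtain ⟨p, hp⟩ := I.nonempty_interior
  obtain ⟨r', hr', hball⟩ := Metric.isOpen_iff.1 isOpen_interior p hp
  let N := ∑ i, ‖v i‖
  have hvN : ∀ i, ‖v i‖ ≤ N := fun i =>
    Finset.single_le_sum (f := fun i => ‖v i‖) (fun _ _ => norm_nonneg _) (Finset.mem_univ i)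
  have hN0 : 0 ≤ N := Finset.sum_nonneg fun _ _ => norm_nonneg _
  let r := r' / (N + 1)
  have hr : 0 < r := by positivity
  have hq : ∀ i, p + r • v i ∈ range I := fun i => by
    refine interior_subset (hball ?_)
    rw [Metric.mem_ball, dist_eq_norm, add_sub_cancel_left, norm_smul, Real.norm_of_nonneg hr.le,
      div_mul_eq_mul_div, div_lt_iff₀ (by positivity)]
    nlinarith [hvN i]
  let R := ‖p - extChartAt I x₀ x₀‖ + r * N + 1
  have hR : 0 < R := by positivity
  obtain ⟨K, hK, s₀, hs₀, hlog⟩ := M.exists_log_toward x₀ hR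
  let n : ℝ := Fintype.card (Fin (Module.finrank ℝ F))
  -- Two errors `K s²` divided by `s r` give `s A`, the distance to the basis. Two bounds `C K s`
  -- divided by `s r` give `A C`, the bound on the images. Shrinking `s` improves only the former.
  let A := 2 * K / r
  have hA : 0 < A := by positivity
  let s := min s₀ (1 / (2 * (n * L * A + 1)))
  have hn : 0 ≤ n := Nat.cast_nonneg _
  have hs : 0 < s := lt_min hs₀ (by positivity)
  have hδ : n * (L * (s * A)) ≤ 1 / 2 := by
    have h1 : s ≤ 1 / (2 * (n * L * A + 1)) := min_le_right _ _
    rw [le_div_iff₀ (by positivity)] at h1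
    have : 0 ≤ n * L * A := by positivity
    nlinarith
  refine ⟨L * (2 * n * A) + 1, by positivity, ?_⟩
  filter_upwards [hlog s ⟨hs, min_le_left _ _⟩, (continuousAt_extChartAt (I := I)
    x₀).preimage_mem_nhds (Metric.ball_mem_nhds _ one_pos)] with θ hθ hθ1 C hC l hl ξ
  obtain ⟨hsrc, hθ⟩ := hθ
  set y := extChartAt I x₀ θ
  have hy : ‖extChartAt I x₀ x₀ - y‖ < 1 := by
    rw [← dist_eq_norm, dist_comm]; exact hθ1
  have hpy : ‖p - y‖ ≤ ‖p - extChartAt I x₀ x₀‖ + 1 := by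
    have := norm_sub_le_norm_sub_add_norm_sub p (extChartAt I x₀ x₀) y
    linarith
  obtain ⟨η₀, hη₀, hη₀n, hη₀c⟩ := hθ p (interior_subset hp) (hpy.trans (by
    have : 0 ≤ r * N := by positivity
    linarith))
  have hqR : ∀ i, ‖p + r • v i - y‖ ≤ R := fun i => by
    have h1 : ‖p + r • v i - y‖ ≤ ‖p - y‖ + ‖r • v i‖ := by
      rw [show p + r • v i - y = (p - y) + r • v i by abel]
      exact norm_add_le _ _
    have h2 : ‖r • v i‖ ≤ r * N := by
      rw [norm_smul, Real.norm_of_nonneg hr.le]; gcongr; exact hvN i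
    linarith
  choose η hη hηn hηc using fun i => hθ _ (hq i) (hqR i)
  have hsr : 0 < s * r := by positivity
  have key := norm_le_of_near_basis v (coord I x₀ θ) (coord_bijective hsrc) l hL0 hL hδ
    (κ := fun i => (s * r)⁻¹ • (η i - η₀)) (B := A * C) (fun i => ?_) (fun i => ?_) ξ
  · refine key.trans ?_
    have h1 : 0 ≤ C * ‖coord I x₀ θ ξ‖ := by positivity
    calc _ = L * (2 * n * A) * (C * ‖coord I x₀ θ ξ‖) := by ring
      _ ≤ (L * (2 * n * A) + 1) * (C * ‖coord I x₀ θ ξ‖) := by gcongr; linarith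
      _ = _ := by ring
  · have h1 : v i - coord I x₀ θ ((s * r)⁻¹ • (η i - η₀)) =
        (s * r)⁻¹ • ((s • (p + r • v i - y) - coord I x₀ θ (η i)) -
          (s • (p - y) - coord I x₀ θ η₀)) := by
      rw [map_smul, map_sub, show s • (p + r • v i - y) = s • (p - y) + (s * r) • v i by
        rw [mul_smul, ← smul_add]; congr 1; abel]
      rw [show s • (p - y) + (s * r) • v i - coord I x₀ θ (η i) - (s • (p - y) - coord I x₀ θ η₀)
        = (s * r) • v i - (coord I x₀ θ (η i) - coord I x₀ θ η₀) by abel,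
        smul_sub _ ((s * r) • v i), inv_smul_smul₀ hsr.ne']
    rw [h1, norm_smul, norm_inv, Real.norm_of_nonneg hsr.le, inv_mul_le_iff₀ hsr]
    refine (norm_sub_le _ _).trans ((add_le_add (hηc i) hη₀c).trans (le_of_eq ?_))
    simp only [A]; field_simp; ring
  · rw [map_smul, map_sub, norm_smul, norm_inv, Real.norm_of_nonneg hsr.le,
      inv_mul_le_iff₀ hsr]
    have h1 : ‖l (η i)‖ ≤ C * (K * s) := (hl _ (hη i)).trans (by gcongr; exact hηn i)
    have h2 : ‖l η₀‖ ≤ C * (K * s) := (hl _ hη₀).trans (by gcongr)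
    refine (norm_sub_le _ _).trans ((add_le_add h1 h2).trans (le_of_eq ?_))
    simp only [A]; field_simp; ring

end Uniform

/-! ### Continuity of `B` along displacements and difference quotients of curves. -/

section Transport

set_option linter.unusedSectionVars false

variable {F : Type*} [NormedAddCommGroup F] [NormedSpace ℝ F]
  {H : Type*} [TopologicalSpace H] {I : ModelWithCorners ℝ F H}
  {S : Type*} [MetricSpace S] [ChartedSpace H S] [IsManifold I ∞ S]
  [RiemannianBundle (fun x : S => TangentSpace I x)]

/-- Integrating the bound on the time derivative along the geodesic compares `B` at its two ends
with an error quadratic in `‖η‖`. -/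
lemma Model.exists_B_bounds {d : ℕ} {Ω : Set (V d)} (M : Model I S Ω) :
    ∃ C : ℝ≥0, 0 < C ∧ ∀ θ, ∀ η ∈ M.D θ, ∀ x,
      ‖M.B θ η x‖ ≤ C * ‖η‖ ∧ ‖fderiv ℝ (M.B θ η) x‖ ≤ C * ‖η‖ ∧
      ‖M.B _ (velocity I (expCurve I θ η) 1) x - M.B θ η x‖ ≤ C * ‖η‖ ^ 2 := by
  obtain ⟨C, hC, h⟩ := M.B_bounds
  refine ⟨C, hC, fun θ η hη x => ?_⟩
  obtain ⟨-, h1, h2⟩ := h θ η hη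
  refine ⟨(h1 x).1, (h1 x).2, ?_⟩
  have h3 := (convex_Icc (0 : ℝ) 1).norm_image_sub_le_of_norm_derivWithin_le
    (fun t ht => (h2 x t ht).1) (fun t ht => (h2 x t ht).2)
    (left_mem_Icc.2 zero_le_one) (right_mem_Icc.2 zero_le_one)
  have h0 : M.B _ (velocity I (expCurve I θ η) 0) = M.B θ η :=
    congrArg (fun p : TangentBundle I S => M.B p.1 p.2) (M.isGeodesicFrom_expCurve hη).2
  simpa [h0] using h3

variable [IsContMDiffRiemannianBundle I ∞ F (fun x : S => TangentSpace I x)]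
  [IsRiemannianManifold I S] [FiniteDimensional ℝ F]

/-- In a chart, `B` is continuous along the direction of the displacement. -/
lemma Model.exists_B_local {d : ℕ} {Ω : Set (V d)} (M : Model I S Ω) (x₀ : S) :
    ∃ K > 0, ∃ U ∈ 𝓝 x₀, U ⊆ (extChartAt I x₀).source ∧
      (∀ θ ∈ U, ∀ (ξ : TangentSpace I θ) x,
        ‖ξ‖ ≤ K * ‖coord I x₀ θ ξ‖ ∧ ‖M.B θ ξ x‖ ≤ K * ‖coord I x₀ θ ξ‖) ∧
      (∀ θ ∈ U, ∀ θ' ∈ U, ‖extChartAt I x₀ θ' - extChartAt I x₀ θ‖ ≤ K * dist θ θ') ∧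
      (∀ θ ∈ U, ∀ θ' ∈ U, ∀ η ∈ M.D θ, expCurve I θ η 1 = θ' →
        ‖extChartAt I x₀ θ' - extChartAt I x₀ θ - coord I x₀ θ η‖ ≤ K * dist θ θ' ^ 2) ∧
      ∀ θ ∈ U, ∀ θ' ∈ U, ∀ (ξ : TangentSpace I θ) (ξ' : TangentSpace I θ'),
        coord I x₀ θ ξ = coord I x₀ θ' ξ' → ∀ (τ : ℝ) x,
        |τ| * ‖M.B θ ξ x - M.B θ' ξ' x‖ ≤ K * (dist θ θ' ^ 2 +
          ‖extChartAt I x₀ θ' - extChartAt I x₀ θ - τ • coord I x₀ θ ξ‖) := by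
  obtain ⟨C, hC, hB⟩ := M.exists_B_bounds
  obtain ⟨K₁, hK₁, U, hU, hsrc, hnorm, hlog⟩ := M.exists_log_estimates x₀
  obtain ⟨K₂, hK₂, hbd⟩ := M.exists_norm_le_of_bounded_on_D x₀ (V d)
  let K₃ := K₂ * C
  have hK₃ : 0 < K₃ := by positivity
  have hlin : ∀ᶠ θ in 𝓝 x₀, ∀ (ξ : TangentSpace I θ) x,
      ‖M.B θ ξ x‖ ≤ K₃ * ‖coord I x₀ θ ξ‖ := by
    filter_upwards [hbd] with θ hθ ξ x
    exact hθ C C.2 ((LinearMap.proj x).comp (M.B θ)) (fun η hη => (hB θ η hη x).1) ξ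
  let K := K₁ + 2 * K₃ + (3 * K₃ * K₁ + C)
  have hCpos : (0 : ℝ) < C := hC
  refine ⟨K, by positivity, U ∩ _, inter_mem hU hlin, fun θ hθ => hsrc hθ.1, ?_, ?_, ?_, ?_⟩
  · intro θ hθ ξ x
    have h1 := (hnorm θ hθ.1 ξ).2
    have h2 := hθ.2 ξ x
    constructor
    · exact h1.trans (by gcongr; simp only [K]; nlinarith)
    · exact h2.trans (by gcongr; simp only [K]; nlinarith)
  · intro θ hθ θ' hθ'
    obtain ⟨η, hη, rfl⟩ := M.D_joins θ θ'
    rw [← M.D_dist θ η hη]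
    exact (hlog θ hθ.1 η hη hθ'.1).1.trans (by gcongr; simp only [K]; nlinarith)
  · rintro θ hθ θ' hθ' η hη rfl
    rw [← M.D_dist θ η hη]
    exact (hlog θ hθ.1 η hη hθ'.1).2.1.trans (by gcongr; simp only [K]; nlinarith)
  -- The comparison runs through the geodesic from `θ` to `θ'`: `τ B ξ` is close to `B η`, this to
  -- `B` of the final velocity, and this to `τ B ξ'`. The outer steps use the local linear bound,
  -- the middle one the control of `B` along geodesics.
  · intro θ hθ θ' hθ' ξ ξ' hξ τ x
    obtain ⟨η, hη, rfl⟩ := M.D_joins θ θ'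
    rw [← M.D_dist θ η hη]
    obtain ⟨-, h1, h2⟩ := hlog θ hθ.1 η hη hθ'.1
    set w := extChartAt I x₀ (expCurve I θ η 1) - extChartAt I x₀ θ
    have h3 := hθ.2 (τ • ξ - η) x
    have h4 := hθ'.2 (velocity I (expCurve I θ η) 1 - τ • ξ') x
    have h5 := (hB θ η hη x).2.2
    rw [map_sub, map_sub, map_smul, map_smul] at h3 h4
    rw [← hξ] at h4
    have h6 : ‖τ • coord I x₀ θ ξ - coord I x₀ θ η‖ ≤
        ‖w - τ • coord I x₀ θ ξ‖ + K₁ * ‖η‖ ^ 2 := by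
      rw [show τ • coord I x₀ θ ξ - coord I x₀ θ η =
        (w - coord I x₀ θ η) - (w - τ • coord I x₀ θ ξ) by abel]
      refine (norm_sub_le _ _).trans ?_
      linarith
    have h7 : ‖coord I x₀ _ (velocity I (expCurve I θ η) 1) - τ • coord I x₀ θ ξ‖ ≤
        ‖w - τ • coord I x₀ θ ξ‖ + 2 * K₁ * ‖η‖ ^ 2 := by
      rw [show coord I x₀ _ (velocity I (expCurve I θ η) 1) - τ • coord I x₀ θ ξ =
        (coord I x₀ _ (velocity I (expCurve I θ η) 1) - coord I x₀ θ η) - (τ • coord I x₀ θ ξ - coord I x₀ θ η) by abel]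
      refine (norm_sub_le _ _).trans ?_
      linarith
    have h8 : |τ| * ‖M.B θ ξ x - M.B _ ξ' x‖ =
        ‖(τ • M.B θ ξ - M.B θ η) x + (M.B θ η x - M.B _ (velocity I (expCurve I θ η) 1) x) +
          (M.B _ (velocity I (expCurve I θ η) 1) - τ • M.B _ ξ') x‖ := by
      rw [← Real.norm_eq_abs, ← norm_smul]
      congr 1
      simp only [Pi.sub_apply, Pi.smul_apply, smul_sub]
      abel
    rw [h8]
    refine (norm_add₃_le).trans ?_
    rw [norm_sub_rev (M.B θ η x)]
    calc _ ≤ K₃ * (‖w - τ • coord I x₀ θ ξ‖ + K₁ * ‖η‖ ^ 2) + C * ‖η‖ ^ 2 +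
          K₃ * (‖w - τ • coord I x₀ θ ξ‖ + 2 * K₁ * ‖η‖ ^ 2) := by
          gcongr
          · exact h3.trans (by gcongr)
          · exact h4.trans (by gcongr)
      _ = 2 * K₃ * ‖w - τ • coord I x₀ θ ξ‖ + (3 * K₃ * K₁ + C) * ‖η‖ ^ 2 := by ring
      _ ≤ K * ‖w - τ • coord I x₀ θ ξ‖ + K * ‖η‖ ^ 2 := by
          have : 0 < K₃ * K₁ := by positivity
          gcongr <;> simp only [K] <;> nlinarith
      _ = _ := by ring

/-- At a point of differentiability, `B_{γ(t)} γ'(t)` is a limit of difference quotients built from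
minimizing geodesics. -/
lemma Model.B_velocity_approx {d : ℕ} {Ω : Set (V d)} (M : Model I S Ω) {γ : ℝ → S} {L : ℝ≥0}
    (hγ : LipschitzOnWith L γ (Icc 0 1)) {t : ℝ} (ht : t ∈ Icc (0 : ℝ) 1)
    (hd : MDifferentiableWithinAt 𝓘(ℝ, ℝ) I γ (Icc 0 1) t) {ε : ℝ} (hε : 0 < ε) :
    ∃ δ > 0, ∀ s ∈ Icc (0 : ℝ) 1, ∀ s' ∈ Icc (0 : ℝ) 1, s ≤ t → t ≤ s' → s < s' → s' - s < δ →
      ∀ η ∈ M.D (γ s), expCurve I (γ s) η 1 = γ s' → ∀ x,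
        ‖(s' - s)⁻¹ • M.B (γ s) η x - M.B (γ t) (velocity I γ t) x‖ ≤ ε := by
  obtain ⟨K, hK, U, hU, hsrc, hlin, -, hlog, hdir⟩ := M.exists_B_local (γ t)
  have hu := coord_velocity I hd (hsrc (mem_of_mem_nhds hU))
  set a := coord I (γ t) _ (velocity I γ t) with ha
  let u : ℝ → F := fun s => extChartAt I (γ t) (γ s)
  -- Each of the two estimates below contributes `K ε₁ = ε / 4`. The other half of `ε` pays for the
  -- terms `K (K + 1) L² h`, which fixes the second bound on `δ`.
  let ε₁ := ε / (4 * K)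
  have hε₁ : 0 < ε₁ := by positivity
  have h1 : ∀ᶠ s in 𝓝[Icc 0 1] t, ‖u s - u t - (s - t) • a‖ ≤ ε₁ * ‖s - t‖ :=
    (hasDerivWithinAt_iff_isLittleO.1 hu).def hε₁
  have h2 : ∀ᶠ s in 𝓝[Icc 0 1] t, γ s ∈ U := hγ.continuousOn t ht hU
  obtain ⟨δ₁, hδ₁, hball⟩ := Metric.mem_nhdsWithin_iff.1 (h1.and h2)
  have hP : 0 < K * (K + 1) * ((L : ℝ) ^ 2 + 1) := by positivity
  refine ⟨min δ₁ (ε / (2 * (K * (K + 1) * ((L : ℝ) ^ 2 + 1)))), lt_min hδ₁ (by positivity),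
    fun s hs s' hs' hst hts' hlt hδ η hη hexp x => ?_⟩
  have hδa : s' - s < δ₁ := hδ.trans_le (min_le_left _ _)
  have hδb : s' - s < ε / (2 * (K * (K + 1) * ((L : ℝ) ^ 2 + 1))) := hδ.trans_le (min_le_right _ _)
  obtain ⟨hsu, hsU⟩ := hball ⟨by rw [Metric.mem_ball, Real.dist_eq, abs_lt]; constructor <;> linarith,
    hs⟩
  obtain ⟨hsu', hsU'⟩ := hball ⟨by
    rw [Metric.mem_ball, Real.dist_eq, abs_lt]; constructor <;> linarith, hs'⟩
  have htU : γ t ∈ U := mem_of_mem_nhds hU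
  rw [Real.norm_eq_abs, abs_of_nonpos (by linarith)] at hsu
  rw [Real.norm_eq_abs, abs_of_nonneg (by linarith)] at hsu'
  -- The vector `ξ` at `γ s` has the same coordinates as the velocity at `γ t`. One estimate
  -- compares vectors over the fixed base point `γ s`; the other moves the base point to `γ t`.
  obtain ⟨ξ, hξ⟩ := exists_coord_eq I (hsrc hsU) a
  set h := s' - s with hh
  have hpos : 0 < h := by linarith
  have hLd : ∀ r ∈ Icc (0 : ℝ) 1, ∀ r' ∈ Icc (0 : ℝ) 1, r ≤ r' →
      dist (γ r) (γ r') ^ 2 ≤ (L : ℝ) ^ 2 * (r' - r) ^ 2 := fun r hr r' hr' hrr => by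
    have := hγ.dist_le_mul r hr r' hr'
    rw [Real.dist_eq, abs_sub_comm, abs_of_nonneg (by linarith)] at this
    rw [← mul_pow]; gcongr
  have hfirst : ‖h⁻¹ • M.B (γ s) η x - M.B (γ s) ξ x‖ ≤ K * (K * L ^ 2 * h + ε₁) := by
    have h3 := (hlin _ hsU (h⁻¹ • η - ξ) x).2
    rw [map_sub, map_sub, map_smul, map_smul, hξ] at h3
    refine h3.trans ?_
    gcongr
    have h4 : h⁻¹ • coord I (γ t) (γ s) η - a = h⁻¹ • (coord I (γ t) (γ s) η - h • a) := by
      rw [smul_sub, inv_smul_smul₀ hpos.ne']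
    rw [h4, norm_smul, norm_inv, Real.norm_of_nonneg hpos.le, inv_mul_le_iff₀ hpos]
    have h5 := hlog _ hsU _ hsU' η hη hexp
    -- Since `s ≤ t ≤ s'`, the two first order errors at `t` add up to at most `ε₁ h`.
    have h6 : coord I (γ t) (γ s) η - h • a = ((u s' - u t - (s' - t) • a) -
        (u s - u t - (s - t) • a)) - (u s' - u s - coord I (γ t) (γ s) η) := by
      rw [show h = (s' - t) - (s - t) by rw [hh]; ring, sub_smul]; abel
    rw [h6]
    have h7 := hLd s hs s' hs' hlt.le
    have h8 := norm_sub_le ((u s' - u t - (s' - t) • a) - (u s - u t - (s - t) • a))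
      (u s' - u s - coord I (γ t) (γ s) η)
    have h9 := norm_sub_le (u s' - u t - (s' - t) • a) (u s - u t - (s - t) • a)
    have h10 : K * dist (γ s) (γ s') ^ 2 ≤ K * (L ^ 2 * h ^ 2) := by gcongr
    have h11 : ‖u s' - u s - coord I (γ t) (γ s) η‖ ≤ K * dist (γ s) (γ s') ^ 2 := h5
    rw [hh] at *
    nlinarith
  have hsecond : ‖M.B (γ s) ξ x - M.B (γ t) (velocity I γ t) x‖ ≤ K * (L ^ 2 * h + ε₁) := by
    -- The directional estimate carries the factor `t - s` and says nothing when it vanishes; in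
    -- that case `ξ` is the velocity itself.
    rcases hst.eq_or_lt with rfl | hst'
    · have : ξ = velocity I γ s := (coord_bijective (hsrc hsU)).1 (hξ.trans ha)
      rw [this, sub_self, norm_zero]
      positivity
    · have h3 := hdir _ hsU _ htU ξ (velocity I γ t) hξ (t - s) x
      rw [hξ, abs_of_pos (by linarith)] at h3
      have h4 := hLd s hs t ht hst
      have h5 : ‖extChartAt I (γ t) (γ t) - extChartAt I (γ t) (γ s) - (t - s) • a‖ ≤
          ε₁ * (t - s) := by
        rw [show extChartAt I (γ t) (γ t) - extChartAt I (γ t) (γ s) - (t - s) • a =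
          -(u s - u t - (s - t) • a) by simp only [u, sub_smul]; abel, norm_neg]
        linarith
      have h6 : 0 < t - s := by linarith
      refine le_of_mul_le_mul_left (h3.trans ?_) h6
      calc _ ≤ K * (L ^ 2 * (t - s) ^ 2 + ε₁ * (t - s)) := by gcongr
        _ = (t - s) * (K * (L ^ 2 * (t - s) + ε₁)) := by ring
        _ ≤ _ := by gcongr; linarith
  have htot := norm_sub_le_norm_sub_add_norm_sub (h⁻¹ • M.B (γ s) η x) (M.B (γ s) ξ x)
    (M.B (γ t) (velocity I γ t) x)
  refine htot.trans ((add_le_add hfirst hsecond).trans ?_)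
  have e1 : K * ε₁ = ε / 4 := by simp only [ε₁]; field_simp
  rw [lt_div_iff₀ (by positivity)] at hδb
  have e2 : 0 ≤ K * (K + 1) * h := by positivity
  nlinarith

/-- Rademacher's theorem for curves in a manifold. -/
lemma Model.ae_mdifferentiableWithinAt {d : ℕ} {Ω : Set (V d)} (M : Model I S Ω) {γ : ℝ → S}
    {L : ℝ≥0} (hγ : LipschitzOnWith L γ (Icc 0 1)) :
    ∀ᵐ t, t ∈ Icc (0 : ℝ) 1 → MDifferentiableWithinAt 𝓘(ℝ, ℝ) I γ (Icc 0 1) t := by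
  rw [ae_iff]
  refine measure_null_of_locally_null _ fun t ht => ?_
  have ht1 : t ∈ Icc (0 : ℝ) 1 := by by_contra h; exact ht fun h' => absurd h' h
  obtain ⟨K, hK, U, hU, hsrc, -, hLip, -, -⟩ := M.exists_B_local (γ t)
  obtain ⟨δ, hδ, hball⟩ := Metric.mem_nhdsWithin_iff.1 (hγ.continuousOn t ht1 hU)
  -- Near `t` a single chart suffices, and there the coordinates of the curve are Lipschitz with
  -- values in `F`, so the vector-valued theorem applies.
  have hu : LipschitzOnWith (K.toNNReal * L) (fun s => extChartAt I (γ t) (γ s))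
      (Metric.ball t δ ∩ Icc 0 1) := by
    refine LipschitzOnWith.of_dist_le_mul fun s hs s' hs' => ?_
    have h1 := hLip _ (hball hs) _ (hball hs')
    have h2 := hγ.dist_le_mul s hs.2 s' hs'.2
    rw [dist_comm, dist_eq_norm, NNReal.coe_mul, Real.coe_toNNReal _ hK.le, mul_assoc]
    exact h1.trans (by gcongr)
  have hae := hu.ae_differentiableWithinAt_of_mem_real
  refine ⟨_, ?_, ae_iff.1 hae⟩
  filter_upwards [self_mem_nhdsWithin, nhdsWithin_le_nhds (Metric.ball_mem_nhds t hδ)]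
    with s hs hsb
  have hs1 : s ∈ Icc (0 : ℝ) 1 := by by_contra h; exact hs fun h' => absurd h' h
  refine fun hcon => hs fun _ => ?_
  rw [mdifferentiableWithinAt_iff_target_of_mem_source (y := γ t)
    (by simpa using hsrc (hball ⟨hsb, hs1⟩))]
  refine ⟨hγ.continuousOn s hs1, mdifferentiableWithinAt_iff_differentiableWithinAt.2 ?_⟩
  exact (hcon ⟨hsb, hs1⟩).mono_of_mem_nhdsWithin
    (inter_mem (nhdsWithin_le_nhds (Metric.isOpen_ball.mem_nhds hsb)) self_mem_nhdsWithin)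

end Transport

/-! ### Approximation by gradient fields that are piecewise constant in time. -/

/-- `w` is, at almost every time in `[0,1]`, a pointwise limit of piecewise constant (in time)
gradient fields which are uniformly bounded and uniformly Lipschitz in space. -/
structure IsStepLimit {d : ℕ} (A : ℝ≥0) (g : ℕ → ℤ → V d → V d) (w : ℝ → V d → V d) : Prop where
  gradient : ∀ n k, ∃ f : V d → ℝ, ∀ x, HasGradientAt f (g n k x) x
  bound : ∀ n k x, ‖g n k x‖ ≤ A
  lipschitz : ∀ n k, LipschitzWith A (g n k)
  tendsto : ∀ᵐ t, t ∈ Icc (0 : ℝ) 1 → ∀ x,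
    Tendsto (fun n : ℕ => g n ⌊(n : ℝ) * t⌋ x) atTop (𝓝 (w t x))

section Step

set_option linter.unusedSectionVars false

variable {F : Type*} [NormedAddCommGroup F] [NormedSpace ℝ F]
  {H : Type*} [TopologicalSpace H] {I : ModelWithCorners ℝ F H}
  {S : Type*} [MetricSpace S] [ChartedSpace H S] [IsManifold I ∞ S]
  [RiemannianBundle (fun x : S => TangentSpace I x)]
  [IsContMDiffRiemannianBundle I ∞ F (fun x : S => TangentSpace I x)]
  [IsRiemannianManifold I S] [FiniteDimensional ℝ F]

/-- The logarithm of `γ((k+1)/n)` at `γ(k/n)` has norm equal to the distance, at most `L / n`.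
Multiplied by `n` it yields fields with sup norm and Lipschitz constant at most `C L`, uniformly in
`n` and `k`. -/
lemma Model.exists_isStepLimit {d : ℕ} {Ω : Set (V d)} (M : Model I S Ω) :
    ∃ C : ℝ≥0, 0 < C ∧ ∀ (γ : ℝ → S) (L : ℝ≥0), LipschitzOnWith L γ (Icc 0 1) →
      ∃ g, IsStepLimit (C * L) g (fun t => M.B (γ t) (velocity I γ t)) := by
  classical
  obtain ⟨C, hC, hB⟩ := M.exists_B_bounds
  refine ⟨C, hC, fun γ L hγ => ?_⟩
  choose lg hlg hexp using M.D_joins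
  let p : ℕ → ℤ → S := fun n k => γ ((k : ℝ) / n)
  -- Indices whose interval is not contained in `[0,1]` get the zero field, which satisfies the same
  -- bounds.
  let ζ : ∀ n k, TangentSpace I (p n k) := fun n k =>
    if 0 ≤ k ∧ k + 1 ≤ n then (n : ℝ) • lg (p n k) (p n (k + 1)) else 0
  have hmem : ∀ (n : ℕ) (k : ℤ), 0 ≤ k → k + 1 ≤ n → 0 < (n : ℝ) ∧ (k : ℝ) / n ∈ Icc (0 : ℝ) 1 ∧
      ((k + 1 : ℤ) : ℝ) / n ∈ Icc (0 : ℝ) 1 ∧ ((k + 1 : ℤ) : ℝ) / n - (k : ℝ) / n = (n : ℝ)⁻¹ := by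
    intro n k h0 h1
    have hn : (0 : ℝ) < n := by
      have : (0 : ℤ) < n := by omega
      exact_mod_cast this
    have h0' : (0 : ℝ) ≤ k := by exact_mod_cast h0
    have h1' : ((k + 1 : ℤ) : ℝ) ≤ n := by exact_mod_cast h1
    push_cast at h1' ⊢
    refine ⟨hn, ⟨by positivity, ?_⟩, ⟨by positivity, ?_⟩, ?_⟩
    · rw [div_le_one hn]; linarith
    · rw [div_le_one hn]; linarith
    · field_simp; ring
  have hζ : ∀ n k, (∀ x, ‖M.B _ (ζ n k) x‖ ≤ C * L) ∧
      ∀ x, ‖fderiv ℝ (M.B _ (ζ n k)) x‖ ≤ C * L := by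
    intro n k
    by_cases h : 0 ≤ k ∧ k + 1 ≤ n
    · simp only [ζ, if_pos h, map_smul]
      obtain ⟨hn, h1, h2, h3⟩ := hmem n k h.1 h.2
      have h4 : (n : ℝ) * (C * ‖lg (p n k) (p n (k + 1))‖) ≤ C * L := by
        have h5 := hγ.dist_le_mul _ h1 _ h2
        rw [dist_comm ((k : ℝ) / n), Real.dist_eq, h3, abs_of_pos (by positivity)] at h5
        rw [M.D_dist _ _ (hlg _ _), hexp]
        have h6 : (n : ℝ) * (C * dist (p n k) (p n (k + 1))) ≤ n * (C * (L * (n : ℝ)⁻¹)) := by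
          gcongr
        refine h6.trans (le_of_eq ?_)
        field_simp
      constructor
      · intro x
        rw [Pi.smul_apply, norm_smul, Real.norm_of_nonneg hn.le]
        exact le_trans (by gcongr; exact (hB _ _ (hlg _ _) x).1) h4
      · intro x
        rw [fderiv_const_smul_field, Pi.smul_apply, norm_smul, Real.norm_of_nonneg hn.le]
        exact le_trans (by gcongr; exact (hB _ _ (hlg _ _) x).2.1) h4
    · simp only [ζ, if_neg h, map_zero]
      constructor
      · intro x; simp; positivity
      · intro x
        rw [show (0 : V d → V d) = fun _ => 0 from rfl]
        simp; positivity
  refine ⟨fun n k => M.B _ (ζ n k), fun n k => M.B_gradient _ _, fun n k x => by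
    simpa using (hζ n k).1 x, fun n k => ?_, ?_⟩
  · refine lipschitzWith_of_nnnorm_fderiv_le
      ((M.B_contDiff _ _).differentiable one_ne_zero) fun x => ?_
    rw [← NNReal.coe_le_coe]
    simpa using (hζ n k).2 x
  -- At `t = 1` the index `⌊n t⌋ = n` selects the zero field, so this one time is discarded.
  · have hne : ∀ᵐ t : ℝ, t ≠ 1 := by simp [ae_iff, measure_singleton]
    filter_upwards [M.ae_mdifferentiableWithinAt hγ, hne] with t hd ht1 ht x
    rw [Metric.tendsto_atTop]
    intro ε hε
    obtain ⟨δ, hδ, happ⟩ := M.B_velocity_approx hγ ht (hd ht) (half_pos hε)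
    obtain ⟨N, hN⟩ := exists_nat_gt δ⁻¹
    refine ⟨N, fun n hn => ?_⟩
    have hn0 : (0 : ℝ) < n :=
      (inv_pos.2 hδ).trans (hN.trans_le (by exact_mod_cast hn))
    have hfl := Int.floor_le ((n : ℝ) * t)
    have hfl' := Int.lt_floor_add_one ((n : ℝ) * t)
    set k := ⌊(n : ℝ) * t⌋ with hk
    have hk0 : 0 ≤ k := Int.floor_nonneg.2 (mul_nonneg hn0.le ht.1)
    have hk1 : k + 1 ≤ n := by
      have h1 : t < 1 := lt_of_le_of_ne ht.2 ht1
      have h2 : (k : ℝ) < n := hfl.trans_lt (by nlinarith)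
      have h3 : k < n := by exact_mod_cast h2
      omega
    obtain ⟨-, h1, h2, h3⟩ := hmem n k hk0 hk1
    have h4 := happ _ h1 _ h2 (by rw [div_le_iff₀ hn0]; linarith)
      (by rw [le_div_iff₀ hn0]; push_cast; linarith) (by
        have : 0 < (n : ℝ)⁻¹ := by positivity
        linarith) (by
        rw [h3, inv_lt_comm₀ hn0 hδ]
        exact hN.trans_le (by exact_mod_cast hn)) (lg (p n k) (p n (k + 1))) (hlg _ _) (hexp _ _) x
    rw [h3, inv_inv] at h4
    rw [dist_eq_norm]
    have h5 : M.B _ (ζ n k) x = (n : ℝ) • M.B _ (lg (p n k) (p n (k + 1))) x := by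
      simp only [ζ, if_pos (And.intro hk0 hk1), map_smul, Pi.smul_apply]
    rw [h5]
    exact h4.trans_lt (half_lt_self hε)

end Step

/-- Setting the field to zero off a measurable set of good times makes it an everywhere limit of
jointly measurable step fields, and the uniform bounds pass to this limit. -/
lemma IsStepLimit.exists_measurable {d : ℕ} {A : ℝ≥0} {g : ℕ → ℤ → V d → V d}
    {w : ℝ → V d → V d} (h : IsStepLimit A g w) :
    ∃ w' : ℝ → V d → V d, Measurable (fun p : ℝ × V d => w' p.1 p.2) ∧
      (∀ t x, ‖w' t x‖ ≤ A) ∧ (∀ t, LipschitzWith A (w' t)) ∧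
      ∀ᵐ t, t ∈ Icc (0 : ℝ) 1 → w' t = w t := by
  classical
  let Z := toMeasurable volume {t | ¬ (t ∈ Icc (0 : ℝ) 1 → ∀ x,
    Tendsto (fun n : ℕ => g n ⌊(n : ℝ) * t⌋ x) atTop (𝓝 (w t x)))}
  have hZ : volume Z = 0 := by rw [measure_toMeasurable]; exact ae_iff.1 h.tendsto
  let G := Icc (0 : ℝ) 1 \ Z
  have hG : MeasurableSet G := measurableSet_Icc.diff (measurableSet_toMeasurable _ _)
  have hlim : ∀ t ∈ G, ∀ x, Tendsto (fun n : ℕ => g n ⌊(n : ℝ) * t⌋ x) atTop (𝓝 (w t x)) := by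
    intro t ht
    by_contra hcon
    exact ht.2 (subset_toMeasurable _ _ fun h' => hcon (h' ht.1))
  refine ⟨fun t => if t ∈ G then w t else 0, ?_, fun t x => ?_, fun t => ?_, ?_⟩
  · refine measurable_of_tendsto_metrizable (f := fun (n : ℕ) (p : ℝ × V d) =>
      if p.1 ∈ G then g n ⌊(n : ℝ) * p.1⌋ p.2 else 0) (fun n => ?_) ?_
    · refine Measurable.ite (measurable_fst hG) ?_ measurable_const
      have h1 : Measurable (fun q : ℤ × V d => g n q.1 q.2) :=
        measurable_from_prod_countable_right fun k => (h.lipschitz n k).continuous.measurable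
      exact h1.comp ((Int.measurable_floor.comp (measurable_fst.const_mul _)).prodMk
        measurable_snd)
    · rw [tendsto_pi_nhds]
      rintro ⟨t, x⟩
      by_cases ht : t ∈ G
      · simpa [ht] using hlim t ht x
      · simp [ht]
  · by_cases ht : t ∈ G
    · simp only [if_pos ht]
      exact le_of_tendsto (hlim t ht x).norm (Eventually.of_forall fun n => h.bound _ _ _)
    · simp [ht]
  · by_cases ht : t ∈ G
    · simp only [if_pos ht]
      refine LipschitzWith.of_dist_le_mul fun x y => ?_
      exact le_of_tendsto ((hlim t ht x).dist (hlim t ht y))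
        (Eventually.of_forall fun n => (h.lipschitz _ _).dist_le_mul _ _)
    · simp only [if_neg ht]
      exact LipschitzWith.const' 0
  · have : ∀ᵐ t, t ∉ Z := by rw [ae_iff]; simpa using hZ
    filter_upwards [this] with t ht ht1
    exact if_pos ⟨ht1, ht⟩

/-! ### Flows of fields measurable in time and Lipschitz in space. -/

section Flow

variable {d : ℕ} {A : ℝ≥0} {w : ℝ → V d → V d}

/-- The Picard iterates of a time-dependent vector field. -/
def picard (w : ℝ → V d → V d) : ℕ → ℝ → V d → V d
  | 0 => fun _ x => x
  | n + 1 => fun t x => x + ∫ s in Ioc 0 t, w s (picard w n s x)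

lemma measurable_picard (hw : Measurable (fun p : ℝ × V d => w p.1 p.2)) (n : ℕ) :
    Measurable (fun p : ℝ × V d => picard w n p.1 p.2) := by
  induction n with
  | zero => exact measurable_snd
  | succ n ih =>
    simp only [picard]
    refine measurable_snd.add ?_
    simp_rw [← integral_indicator measurableSet_Ioc]
    have h1 : StronglyMeasurable (fun q : (ℝ × V d) × ℝ =>
        (Ioc 0 q.1.1).indicator (fun s => w s (picard w n s q.1.2)) q.2) := by
      refine Measurable.stronglyMeasurable ?_
      have h2 : Measurable (fun q : (ℝ × V d) × ℝ => w q.2 (picard w n q.2 q.1.2)) :=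
        hw.comp (measurable_snd.prodMk (ih.comp (measurable_snd.prodMk
          (measurable_snd.comp measurable_fst))))
      have h3 : MeasurableSet {q : (ℝ × V d) × ℝ | 0 < q.2 ∧ q.2 ≤ q.1.1} :=
        (measurableSet_lt measurable_const measurable_snd).inter
          (measurableSet_le measurable_snd (measurable_fst.comp measurable_fst))
      exact h2.indicator h3
    exact h1.integral_prod_right.measurable

lemma intervalIntegrable_of_bound {f : ℝ → V d} (hf : Measurable f) (hA : ∀ t, ‖f t‖ ≤ A)
    (a b : ℝ) : IntervalIntegrable f volume a b :=
  (intervalIntegrable_const (c := (A : ℝ))).mono_fun hf.aestronglyMeasurable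
    (Eventually.of_forall fun t => by simpa using hA t)

/-- Each iteration integrates the Lipschitz bound once more, which produces the terms of an
exponential series; summability makes the iterates converge. -/
lemma norm_picard_sub_le (hw : Measurable (fun p : ℝ × V d => w p.1 p.2))
    (hA : ∀ t x, ‖w t x‖ ≤ A) (hL : ∀ t, LipschitzWith A (w t)) (n : ℕ) (x : V d) {t : ℝ}
    (ht : 0 ≤ t) :
    ‖picard w (n + 1) t x - picard w n t x‖ ≤ A ^ (n + 1) * t ^ (n + 1) / (n + 1).factorial := by
  have hm : ∀ n, Measurable (fun s => w s (picard w n s x)) := fun n =>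
    hw.comp (measurable_id.prodMk ((measurable_picard hw n).comp
      (measurable_id.prodMk measurable_const)))
  induction n generalizing t with
  | zero =>
    simp only [picard, add_sub_cancel_left]
    rw [← intervalIntegral.integral_of_le ht]
    have := intervalIntegral.norm_integral_le_of_norm_le_const (a := 0) (b := t)
      (f := fun s => w s x) (C := A) (fun s _ => hA s x)
    simpa [abs_of_nonneg ht] using this
  | succ n ih =>
    have e : picard w (n + 1 + 1) t x - picard w (n + 1) t x =
        ∫ s in (0 : ℝ)..t, (w s (picard w (n + 1) s x) - w s (picard w n s x)) := by
      rw [intervalIntegral.integral_sub (intervalIntegrable_of_bound (hm _) (fun s => hA _ _) _ _)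
        (intervalIntegrable_of_bound (hm _) (fun s => hA _ _) _ _),
        intervalIntegral.integral_of_le ht, intervalIntegral.integral_of_le ht]
      simp only [picard]
      abel
    rw [e]
    have hb : ∀ s ∈ Ioc 0 t, ‖w s (picard w (n + 1) s x) - w s (picard w n s x)‖ ≤
        A ^ (n + 1 + 1) / (n + 1).factorial * s ^ (n + 1) := by
      intro s hs
      have h1 := (hL s).dist_le_mul (picard w (n + 1) s x) (picard w n s x)
      rw [dist_eq_norm, dist_eq_norm] at h1
      refine h1.trans ((mul_le_mul_of_nonneg_left (ih hs.1.le) A.coe_nonneg).trans (le_of_eq ?_))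
      rw [pow_succ (A : ℝ) (n + 1)]
      ring
    have hc : Continuous fun s : ℝ => (A : ℝ) ^ (n + 1 + 1) / (n + 1).factorial * s ^ (n + 1) := by
      fun_prop
    have h2 := intervalIntegral.norm_integral_le_of_norm_le ht
      (Eventually.of_forall fun s hs => hb s hs) (hc.intervalIntegrable (μ := volume) 0 t)
    refine h2.trans (le_of_eq ?_)
    rw [intervalIntegral.integral_const_mul, integral_pow, Nat.factorial_succ (n + 1)]
    push_cast
    field_simp
    ring

/-- Bounded vector fields that are Lipschitz in space and measurable in time have flows. -/
lemma exists_flow (hw : Measurable (fun p : ℝ × V d => w p.1 p.2))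
    (hA : ∀ t x, ‖w t x‖ ≤ A) (hL : ∀ t, LipschitzWith A (w t)) :
    ∃ φ : ℝ → V d → V d, Measurable (fun p : ℝ × V d => φ p.1 p.2) ∧
      ∀ x, ∀ t ∈ Icc (0 : ℝ) 1, φ t x = x + ∫ s in (0 : ℝ)..t, w s (φ s x) := by
  classical
  have hcauchy : ∀ t ∈ Icc (0 : ℝ) 1, ∀ x, ∃ y, Tendsto (fun n => picard w n t x) atTop (𝓝 y) := by
    intro t ht x
    refine cauchySeq_tendsto_of_complete (cauchySeq_of_dist_le_of_summable
      (fun n => (A : ℝ) ^ (n + 1) / (n + 1).factorial) (fun n => ?_) ?_)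
    · rw [dist_comm, dist_eq_norm]
      refine (norm_picard_sub_le hw hA hL n x ht.1).trans ?_
      gcongr
      exact mul_le_of_le_one_right (by positivity) (pow_le_one₀ ht.1 ht.2)
    · exact (summable_nat_add_iff 1).2 (Real.summable_pow_div_factorial A)
  choose! φ hφ using hcauchy
  refine ⟨fun t => if t ∈ Icc (0 : ℝ) 1 then φ t else 0, ?_, fun x t ht => ?_⟩
  · refine measurable_of_tendsto_metrizable (f := fun (n : ℕ) (p : ℝ × V d) =>
      if p.1 ∈ Icc (0 : ℝ) 1 then picard w n p.1 p.2 else 0) (fun n => ?_) ?_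
    · exact Measurable.ite (measurable_fst measurableSet_Icc) (measurable_picard hw n)
        measurable_const
    · rw [tendsto_pi_nhds]
      rintro ⟨t, x⟩
      by_cases ht : t ∈ Icc (0 : ℝ) 1
      · simpa only [if_pos ht] using hφ t ht x
      · simp only [if_neg ht]; exact tendsto_const_nhds
  · have h1 := (hφ t ht x).comp (tendsto_add_atTop_nat 1)
    have h2 : Tendsto (fun n => x + ∫ s in (0 : ℝ)..t, w s (picard w n s x)) atTop
        (𝓝 (x + ∫ s in (0 : ℝ)..t, w s ((if s ∈ Icc (0 : ℝ) 1 then φ s else 0) x))) := by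
      refine tendsto_const_nhds.add
        (intervalIntegral.tendsto_integral_filter_of_dominated_convergence (fun _ => (A : ℝ))
          (Eventually.of_forall fun n => ?_) (Eventually.of_forall fun n =>
            Eventually.of_forall fun s _ => hA _ _) intervalIntegrable_const
          (Eventually.of_forall fun s hs => ?_))
      · exact (hw.comp (measurable_id.prodMk ((measurable_picard hw n).comp
          (measurable_id.prodMk measurable_const)))).aestronglyMeasurable
      · rw [uIoc_of_le ht.1] at hs
        have hs1 : s ∈ Icc (0 : ℝ) 1 := ⟨hs.1.le, hs.2.trans ht.2⟩
        simp only [if_pos hs1]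
        exact ((hL s).continuous.tendsto _).comp (hφ s hs1 x)
    refine tendsto_nhds_unique (by simpa only [if_pos ht] using h1) (h2.congr fun n => ?_)
    rw [Function.comp_apply, intervalIntegral.integral_of_le ht.1]
    rfl

end Flow

/-! ### The continuity equation and the transport cost along a flow. -/

/-- `ρ` is transported by the flow `φ` of the bounded, spatially Lipschitz vector field `w`. -/
structure IsTransport {d : ℕ} {Ω : Set (V d)} (A : ℝ≥0) (w φ : ℝ → V d → V d)
    (ρ : ℝ → ProbOn Ω) : Prop where
  measurable_field : Measurable (fun p : ℝ × V d => w p.1 p.2)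
  bound : ∀ t x, ‖w t x‖ ≤ A
  lipschitz : ∀ t, LipschitzWith A (w t)
  measurable_flow : Measurable (fun p : ℝ × V d => φ p.1 p.2)
  flow : ∀ x, ∀ t ∈ Icc (0 : ℝ) 1, φ t x = x + ∫ s in (0 : ℝ)..t, w s (φ s x)
  push : ∀ t ∈ Icc (0 : ℝ) 1, (ρ t).1 = (ρ 0).1.map (φ t)

/-- The chain rule, in integrated form, along an integral curve with bounded velocity. -/
lemma integral_fderiv_along_curve {d : ℕ} {A : ℝ≥0} {b : ℝ → V d} (hb : Measurable b)
    (hA : ∀ t, ‖b t‖ ≤ A) (x : V d) {Φ : ℝ × V d → ℝ} (hΦ : ContDiff ℝ 1 Φ) :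
    ∫ t in Icc (0 : ℝ) 1, fderiv ℝ Φ (t, x + ∫ s in (0 : ℝ)..t, b s) (1, b t) =
      Φ (1, x + ∫ s in (0 : ℝ)..1, b s) - Φ (0, x) := by
  let ψ : ℝ → V d := fun t => x + ∫ s in (0 : ℝ)..t, b s
  have hii : ∀ s t, IntervalIntegrable b volume s t := intervalIntegrable_of_bound hb hA
  have hψL : LipschitzWith A ψ := by
    refine LipschitzWith.of_dist_le_mul fun s t => ?_
    rw [dist_eq_norm, add_sub_add_left_eq_sub, intervalIntegral.integral_interval_sub_left
      (hii _ _) (hii _ _), Real.dist_eq]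
    exact intervalIntegral.norm_integral_le_of_norm_le_const fun r _ => hA r
  have hpL : LipschitzWith (max 1 A) (fun t => (t, ψ t)) := LipschitzWith.id.prodMk hψL
  let Kc : Set (ℝ × V d) := Icc 0 1 ×ˢ Metric.closedBall x A
  have hmaps : MapsTo (fun t => (t, ψ t)) (Icc (0 : ℝ) 1) Kc := by
    intro t ht
    refine ⟨ht, ?_⟩
    have := hψL.dist_le_mul t 0
    have h0 : ψ 0 = x := by simp [ψ]
    rw [h0, Real.dist_eq, sub_zero, abs_of_nonneg ht.1] at this
    exact this.trans (mul_le_of_le_one_right A.coe_nonneg ht.2)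
  -- The function `Φ` is Lipschitz on the compact convex set containing the trajectory. Hence `t ↦ Φ
  -- (t, ψ t)` is absolutely continuous and the fundamental theorem applies, although `b` is only
  -- measurable.
  obtain ⟨D, hD⟩ := hΦ.contDiffOn.exists_lipschitzOnWith (s := Kc) one_ne_zero
    ((convex_Icc _ _).prod (convex_closedBall _ _))
    (isCompact_Icc.prod (isCompact_closedBall _ _))
  let h : ℝ → ℝ := fun t => Φ (t, ψ t)
  have hhL : LipschitzOnWith (D * max 1 A) h (uIcc 0 1) := by
    rw [uIcc_of_le zero_le_one]
    exact hD.comp (hpL.lipschitzOnWith) hmaps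
  have hFTC := hhL.absolutelyContinuousOnInterval.integral_deriv_eq_sub
  have hloc : LocallyIntegrable b volume := by
    refine (locallyIntegrable_const (A : ℝ)).mono hb.aestronglyMeasurable ?_
    exact Eventually.of_forall fun t => by simpa using hA t
  have hder : ∀ᵐ t, HasDerivAt ψ (b t) t := by
    filter_upwards [LocallyIntegrable.ae_hasDerivAt_integral hloc] with t ht
    exact (ht 0).const_add x
  have hder' : ∀ᵐ t, deriv h t = fderiv ℝ Φ (t, ψ t) (1, b t) := by
    filter_upwards [hder] with t ht
    have h1 : HasDerivAt (fun t => (t, ψ t)) (1, b t) t := (hasDerivAt_id t).prodMk ht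
    exact (((hΦ.differentiable one_ne_zero) (t, ψ t)).hasFDerivAt.comp_hasDerivAt t h1).deriv
  rw [integral_Icc_eq_integral_Ioc, ← intervalIntegral.integral_of_le zero_le_one,
    ← intervalIntegral.integral_congr_ae (hder'.mono fun t ht _ => ht), hFTC]
  simp [h, ψ]

namespace IsTransport

variable {d : ℕ} {Ω : Set (V d)} {A : ℝ≥0} {w φ : ℝ → V d → V d} {ρ : ℝ → ProbOn Ω}

instance (μ : ProbOn Ω) : IsProbabilityMeasure μ.1 := μ.2.1

lemma ae_mem (μ : ProbOn Ω) : ∀ᵐ x ∂μ.1, x ∈ Ω := by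
  rw [ae_iff]; exact μ.2.2

lemma measurable_flow_at (h : IsTransport A w φ ρ) (t : ℝ) : Measurable (φ t) :=
  h.measurable_flow.comp (measurable_const.prodMk measurable_id)

lemma measurable_field_at (h : IsTransport A w φ ρ) (t : ℝ) : Measurable (w t) :=
  h.measurable_field.comp (measurable_const.prodMk measurable_id)

lemma measurable_pair (h : IsTransport A w φ ρ) :
    Measurable (fun p : ℝ × V d => (p.1, φ p.1 p.2)) :=
  measurable_fst.prodMk h.measurable_flow

lemma flow_zero (h : IsTransport A w φ ρ) (x : V d) : φ 0 x = x := by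
  simpa using h.flow x 0 (by simp)

lemma norm_flow_sub_le (h : IsTransport A w φ ρ) (x : V d) {t : ℝ} (ht : t ∈ Icc (0 : ℝ) 1) :
    ‖φ t x - x‖ ≤ A := by
  rw [h.flow x t ht, add_sub_cancel_left]
  refine (intervalIntegral.norm_integral_le_of_norm_le_const fun r _ => h.bound r _).trans ?_
  rw [sub_zero, abs_of_nonneg ht.1]
  exact mul_le_of_le_one_right A.coe_nonneg ht.2

/-- Integrals against the transported measures. -/
lemma integral_eq (h : IsTransport A w φ ρ) {f : ℝ × V d → ℝ} (hf : Measurable f) :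
    ∫ t in Icc (0 : ℝ) 1, ∫ x, f (t, x) ∂(ρ t).1 =
      ∫ t in Icc (0 : ℝ) 1, ∫ x, f (t, φ t x) ∂(ρ 0).1 := by
  refine setIntegral_congr_fun measurableSet_Icc fun t ht => ?_
  have hft : Measurable fun x => f (t, x) := hf.comp (measurable_const.prodMk measurable_id)
  rw [h.push t ht, integral_map (h.measurable_flow_at t).aemeasurable hft.aestronglyMeasurable]

lemma lintegral_eq (h : IsTransport A w φ ρ) {f : ℝ × V d → ℝ≥0∞} (hf : Measurable f) :
    ∫⁻ t in Icc (0 : ℝ) 1, ∫⁻ x, f (t, x) ∂(ρ t).1 =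
      ∫⁻ p, f (p.1, φ p.1 p.2) ∂((volume.restrict (Icc (0 : ℝ) 1)).prod (ρ 0).1) := by
  have hm : Measurable fun p : ℝ × V d => f (p.1, φ p.1 p.2) := hf.comp h.measurable_pair
  rw [lintegral_prod _ hm.aemeasurable]
  refine setLIntegral_congr_fun measurableSet_Icc fun t ht => ?_
  have hft : Measurable fun x => f (t, x) := hf.comp (measurable_const.prodMk measurable_id)
  rw [h.push t ht, lintegral_map hft (h.measurable_flow_at t)]

lemma ae_prod_mem (ρ : ℝ → ProbOn Ω) :
    ∀ᵐ p ∂((volume.restrict (Icc (0 : ℝ) 1)).prod (ρ 0).1), p.1 ∈ Icc (0 : ℝ) 1 ∧ p.2 ∈ Ω := by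
  have h1 : ∀ᵐ t ∂(volume.restrict (Icc (0 : ℝ) 1)), t ∈ Icc (0 : ℝ) 1 :=
    ae_restrict_mem measurableSet_Icc
  have h2 := ae_mem (ρ 0)
  exact (Measure.quasiMeasurePreserving_fst.ae h1).and (Measure.quasiMeasurePreserving_snd.ae h2)

lemma integrable_of_continuous (h : IsTransport A w φ ρ) (hΩ : IsCompact Ω)
    {Ψ : (ℝ × V d) × V d → ℝ} (hΨ : Continuous Ψ) :
    Integrable (fun p : ℝ × V d => Ψ ((p.1, φ p.1 p.2), w p.1 (φ p.1 p.2)))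
      ((volume.restrict (Icc (0 : ℝ) 1)).prod (ρ 0).1) := by
  obtain ⟨R, hR⟩ := hΩ.isBounded.exists_norm_le
  have hc : IsCompact (((Icc (0 : ℝ) 1) ×ˢ Metric.closedBall (0 : V d) (R + A)) ×ˢ
      Metric.closedBall (0 : V d) A) :=
    (isCompact_Icc.prod (isCompact_closedBall _ _)).prod (isCompact_closedBall _ _)
  obtain ⟨D, hD⟩ := hc.exists_bound_of_continuousOn hΨ.continuousOn
  refine Integrable.of_bound (C := D) ?_ ?_
  · exact (hΨ.measurable.comp (h.measurable_pair.prodMk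
      (h.measurable_field.comp h.measurable_pair))).aestronglyMeasurable
  · filter_upwards [ae_prod_mem ρ] with p hp
    refine hD _ ⟨⟨hp.1, ?_⟩, ?_⟩
    · rw [mem_closedBall_zero_iff]
      have h1 := h.norm_flow_sub_le p.2 hp.1
      have h2 := norm_le_insert' (φ p.1 p.2) p.2
      have h3 := hR p.2 hp.2
      linarith
    · simpa using h.bound _ _

/-- Pulling both space-time integrals back along the flow and exchanging their order reduces the
weak equation to the chain rule on each trajectory. -/
lemma mem_CE (h : IsTransport A w φ ρ) (hΩ : IsCompact Ω) : w ∈ CE ρ := by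
  refine ⟨h.measurable_field, fun t _ => MemLp.of_bound
    (h.measurable_field_at t).aestronglyMeasurable A (Eventually.of_forall (h.bound t)),
    fun Φ hΦ => ?_⟩
  have hcd : Continuous (fderiv ℝ Φ) := hΦ.continuous_fderiv one_ne_zero
  have m1 : Measurable (fun p : ℝ × V d => fderiv ℝ Φ p (1, 0)) :=
    (hcd.clm_apply continuous_const).measurable
  have hΨ : Continuous (fun q : (ℝ × V d) × V d => fderiv ℝ Φ q.1 (0, q.2)) :=
    (hcd.comp continuous_fst).clm_apply (continuous_const.prodMk continuous_snd)
  have m2 : Measurable (fun p : ℝ × V d => fderiv ℝ Φ p (0, w p.1 p.2)) :=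
    hΨ.measurable.comp (measurable_id.prodMk h.measurable_field)
  have i1 := h.integrable_of_continuous hΩ (Ψ := fun q => fderiv ℝ Φ q.1 (1, 0))
    ((hcd.comp continuous_fst).clm_apply continuous_const)
  have i2 := h.integrable_of_continuous hΩ hΨ
  rw [h.integral_eq m1, h.integral_eq m2]
  have e1 : ∫ t in Icc (0 : ℝ) 1, ∫ x, fderiv ℝ Φ (t, φ t x) (1, 0) ∂(ρ 0).1 = _ :=
    (integral_prod _ i1).symm
  have e2 : ∫ t in Icc (0 : ℝ) 1, ∫ x, fderiv ℝ Φ (t, φ t x) (0, w t (φ t x)) ∂(ρ 0).1 = _ :=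
    (integral_prod _ i2).symm
  have i3 : Integrable (fun p : ℝ × V d => fderiv ℝ Φ (p.1, φ p.1 p.2) (1, 0) +
      fderiv ℝ Φ (p.1, φ p.1 p.2) (0, w p.1 (φ p.1 p.2)))
      ((volume.restrict (Icc (0 : ℝ) 1)).prod (ρ 0).1) := i1.add i2
  rw [e1, e2, ← integral_add i1 i2, integral_prod_symm _ i3]
  have hflow : ∀ x, ∫ t in Icc (0 : ℝ) 1, (fderiv ℝ Φ (t, φ t x) (1, 0) +
      fderiv ℝ Φ (t, φ t x) (0, w t (φ t x))) = Φ (1, φ 1 x) - Φ (0, φ 0 x) := by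
    intro x
    have hm : Measurable fun t => w t (φ t x) :=
      (h.measurable_field.comp h.measurable_pair).comp (measurable_id.prodMk measurable_const)
    have := integral_fderiv_along_curve hm (fun t => h.bound _ _) x hΦ
    rw [← h.flow x 1 (by simp)] at this
    rw [h.flow_zero, ← this]
    refine setIntegral_congr_fun measurableSet_Icc fun t ht => ?_
    rw [← h.flow x t ht, ← map_add]
    simp
  simp only [hflow]
  have hend : ∀ t ∈ Icc (0 : ℝ) 1, Integrable (fun x => Φ (t, φ t x)) (ρ 0).1 ∧
      ∫ x, Φ (t, x) ∂(ρ t).1 = ∫ x, Φ (t, φ t x) ∂(ρ 0).1 := by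
    intro t ht
    have hm : Measurable fun x => Φ (t, x) :=
      hΦ.continuous.measurable.comp (measurable_const.prodMk measurable_id)
    constructor
    · obtain ⟨R, hR⟩ := hΩ.isBounded.exists_norm_le
      obtain ⟨D, hD⟩ := ((isCompact_singleton (x := t)).prod
        (isCompact_closedBall (0 : V d) (R + A))).exists_bound_of_continuousOn
          hΦ.continuous.continuousOn
      refine Integrable.of_bound (C := D) (hm.comp (h.measurable_flow_at t)).aestronglyMeasurable ?_
      filter_upwards [ae_mem (ρ 0)] with x hx
      refine hD _ ⟨rfl, ?_⟩
      rw [mem_closedBall_zero_iff]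
      have h1 := h.norm_flow_sub_le x ht
      have h2 := norm_le_insert' (φ t x) x
      have h3 := hR x hx
      linarith
    · rw [h.push t ht, integral_map (h.measurable_flow_at t).aemeasurable hm.aestronglyMeasurable]
  obtain ⟨j1, j1'⟩ := hend 1 (by simp)
  obtain ⟨j0, j0'⟩ := hend 0 (by simp)
  rw [integral_sub j1 j0, j1', j0']

/-- The transport cost is bounded by the kinetic energy. -/
lemma W_le (h : IsTransport A w φ ρ) :
    W (ρ 0) (ρ 1) ≤ (∫⁻ t in Icc (0 : ℝ) 1, ∫⁻ x, ‖w t x‖ₑ ^ 2 ∂(ρ t).1) ^ (1 / 2 : ℝ) := by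
  have hm1 := h.measurable_flow_at 1
  have hmw : Measurable fun p : ℝ × V d => w p.1 (φ p.1 p.2) :=
    h.measurable_field.comp h.measurable_pair
  have hp : Measurable fun x : V d => (x, φ 1 x) := measurable_id.prodMk hm1
  have hsq : Measurable fun p : ℝ × V d => ‖w p.1 p.2‖ₑ ^ 2 := h.measurable_field.enorm.pow_const 2
  rw [W, h.lintegral_eq hsq]
  refine ENNReal.rpow_le_rpow ?_ (by norm_num)
  -- The flow map at time one induces a coupling. Each displacement is the integral of the velocity
  -- over a probability space, so its norm is at most the `L²` norm in time.
  have hq : ((ρ 0).1.map fun x => (x, φ 1 x)) ∈ {q : Measure (V d × V d) |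
      q.map Prod.fst = (ρ 0).1 ∧ q.map Prod.snd = (ρ 1).1} := by
    constructor
    · rw [Measure.map_map measurable_fst hp]
      exact Measure.map_id
    · rw [Measure.map_map measurable_snd hp, h.push 1 (by simp)]
      rfl
  refine (iInf₂_le _ hq).trans ?_
  · rw [lintegral_map (by fun_prop) hp, lintegral_prod_symm _ (hmw.enorm.pow_const 2).aemeasurable]
    refine lintegral_mono fun x => ?_
    have hprob : IsProbabilityMeasure (volume.restrict (Icc (0 : ℝ) 1)) := ⟨by simp⟩
    have hmx : Measurable fun t => w t (φ t x) := hmw.comp (measurable_id.prodMk measurable_const)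
    have h1 : ‖x - φ 1 x‖ₑ ≤ eLpNorm (fun t => w t (φ t x)) 2 (volume.restrict (Icc (0 : ℝ) 1)) := by
      refine le_trans ?_ (eLpNorm_le_eLpNorm_of_exponent_le (p := 1) (by norm_num)
        hmx.aestronglyMeasurable)
      rw [eLpNorm_one_eq_lintegral_enorm, ← enorm_neg, neg_sub, h.flow x 1 (by simp),
        add_sub_cancel_left, intervalIntegral.integral_of_le zero_le_one,
        ← integral_Icc_eq_integral_Ioc]
      exact enorm_integral_le_lintegral_enorm _
    refine (pow_le_pow_left' h1 2).trans (le_of_eq ?_)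
    rw [eLpNorm_eq_lintegral_rpow_enorm_toReal (by norm_num) (by norm_num), ← ENNReal.rpow_natCast,
      ← ENNReal.rpow_mul]
    norm_num

end IsTransport

lemma IsStepLimit.congr {d : ℕ} {A : ℝ≥0} {g : ℕ → ℤ → V d → V d} {w w' : ℝ → V d → V d}
    (h : IsStepLimit A g w) (hw : ∀ᵐ t, t ∈ Icc (0 : ℝ) 1 → w' t = w t) : IsStepLimit A g w' where
  gradient := h.gradient
  bound := h.bound
  lipschitz := h.lipschitz
  tendsto := by
    filter_upwards [h.tendsto, hw] with t h1 h2 ht x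
    rw [h2 ht]
    exact h1 ht x

/-! ### Minimality of the kinetic energy. -/

/-- In an `L²` space, a vector has at most the norm of its sum with an orthogonal vector. -/
lemma lintegral_sq_le_of_orthogonal {α : Type*} [MeasurableSpace α] {μ : Measure α} {d : ℕ}
    {f u : α → V d} (hf : MemLp f 2 μ) (hu : MemLp u 2 μ) (h : ∫ p, inner ℝ (f p) (u p) ∂μ = 0) :
    ∫⁻ p, ‖f p‖ₑ ^ 2 ∂μ ≤ ∫⁻ p, ‖f p + u p‖ₑ ^ 2 ∂μ := by
  have hsq : ∀ {k : α → V d}, MemLp k 2 μ → Integrable (fun p => ‖k p‖ ^ 2) μ := fun hk =>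
    (memLp_two_iff_integrable_sq_norm hk.1).1 hk
  have key : ∀ {k : α → V d}, MemLp k 2 μ →
      ∫⁻ p, ‖k p‖ₑ ^ 2 ∂μ = ENNReal.ofReal (∫ p, ‖k p‖ ^ 2 ∂μ) := by
    intro k hk
    rw [ofReal_integral_eq_lintegral_ofReal (hsq hk)
      (Eventually.of_forall fun p => sq_nonneg _)]
    refine lintegral_congr fun p => ?_
    rw [ENNReal.ofReal_pow (norm_nonneg _), ofReal_norm]
  have hinner : Integrable (fun p => inner ℝ (f p) (u p)) μ := by
    refine ((hsq hf).add (hsq hu)).mono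
      (hf.1.inner hu.1) (Eventually.of_forall fun p => ?_)
    have h1 := abs_real_inner_le_norm (f p) (u p)
    have h2 : (0 : ℝ) ≤ ‖f p‖ ^ 2 + ‖u p‖ ^ 2 := by positivity
    rw [Real.norm_eq_abs, Real.norm_eq_abs, Pi.add_apply, abs_of_nonneg h2]
    nlinarith [sq_nonneg (‖f p‖ - ‖u p‖), sq_nonneg ‖f p‖, sq_nonneg ‖u p‖]
  have hsum := key (hf.add hu)
  simp only [Pi.add_apply] at hsum
  rw [key hf, hsum]
  refine ENNReal.ofReal_le_ofReal ?_
  have e : ∀ p, ‖f p + u p‖ ^ 2 = ‖f p‖ ^ 2 + 2 * inner ℝ (f p) (u p) + ‖u p‖ ^ 2 := fun p =>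
    norm_add_sq_real _ _
  simp only [e]
  have hi2 : Integrable (fun p => 2 * inner ℝ (f p) (u p)) μ := hinner.const_mul 2
  have hi3 : Integrable (fun p => ‖f p‖ ^ 2 + 2 * inner ℝ (f p) (u p)) μ :=
    (hsq hf).add hi2
  rw [integral_add hi3 (hsq hu), integral_add (hsq hf) hi2,
    integral_const_mul, h]
  have : 0 ≤ ∫ p, ‖u p‖ ^ 2 ∂μ := integral_nonneg fun p => sq_nonneg _
  linarith

namespace IsTransport

variable {d : ℕ} {Ω : Set (V d)} {A : ℝ≥0} {w φ : ℝ → V d → V d} {ρ : ℝ → ProbOn Ω}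

/-- The difference of two solutions of the continuity equation is orthogonal to fixed gradient
fields, at almost every time. -/
lemma ae_integral_inner_eq_zero (h : IsTransport A w φ ρ) (hΩ : IsCompact Ω)
    {v : ℝ → V d → V d} (hv : v ∈ CE ρ)
    (hv2 : Integrable (fun p : ℝ × V d => v p.1 (φ p.1 p.2))
      ((volume.restrict (Icc (0 : ℝ) 1)).prod (ρ 0).1))
    {f : V d → ℝ} {k : V d → V d} (hf : ∀ x, HasGradientAt f (k x) x) (hk : Continuous k)
    (hkA : ∃ B, ∀ x, ‖k x‖ ≤ B) :
    ∀ᵐ t ∂(volume.restrict (Icc (0 : ℝ) 1)),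
      ∫ x, inner ℝ (k (φ t x)) (v t (φ t x) - w t (φ t x)) ∂(ρ 0).1 = 0 := by
  obtain ⟨B, hB⟩ := hkA
  have hfd : ∀ x, fderiv ℝ f x = InnerProductSpace.toDual ℝ (V d) (k x) := fun x =>
    (hf x).hasFDerivAt.fderiv
  have hfC : ContDiff ℝ 1 f := by
    rw [contDiff_one_iff_fderiv]
    refine ⟨fun x => (hf x).hasFDerivAt.differentiableAt, ?_⟩
    have : fderiv ℝ f = fun x => InnerProductSpace.toDual ℝ (V d) (k x) := funext hfd
    rw [this]
    exact (InnerProductSpace.toDual ℝ (V d)).continuous.comp hk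
  have hvφ : Measurable fun p : ℝ × V d => v p.1 (φ p.1 p.2) := hv.1.comp h.measurable_pair
  have hwφ : Measurable fun p : ℝ × V d => w p.1 (φ p.1 p.2) :=
    h.measurable_field.comp h.measurable_pair
  have hkφ : Measurable fun p : ℝ × V d => k (φ p.1 p.2) := hk.measurable.comp h.measurable_flow
  have integrable_inner :
      ∀ {u : ℝ × V d → V d}, Integrable u ((volume.restrict (Icc (0 : ℝ) 1)).prod (ρ 0).1) →
      Integrable (fun p : ℝ × V d => inner ℝ (k (φ p.1 p.2)) (u p))
        ((volume.restrict (Icc (0 : ℝ) 1)).prod (ρ 0).1) := by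
    intro u hu
    refine (hu.norm.const_mul B).mono' (hkφ.aestronglyMeasurable.inner hu.1)
      (Eventually.of_forall fun p => ?_)
    exact (norm_inner_le_norm _ _).trans (by gcongr; exact hB _)
  have hw2 : Integrable (fun p : ℝ × V d => w p.1 (φ p.1 p.2))
      ((volume.restrict (Icc (0 : ℝ) 1)).prod (ρ 0).1) :=
    Integrable.of_bound hwφ.aestronglyMeasurable A (Eventually.of_forall fun p => h.bound _ _)
  have hdiff := integrable_inner (hv2.sub hw2)
  let m : ℝ → ℝ := fun t => ∫ x, inner ℝ (k (φ t x)) (v t (φ t x) - w t (φ t x)) ∂(ρ 0).1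
  have hm : Integrable m (volume.restrict (Icc (0 : ℝ) 1)) := hdiff.integral_prod_left
  have htest : ∀ χ : ℝ → ℝ, ContDiff ℝ ∞ χ → ∫ t in Icc (0 : ℝ) 1, χ t * m t = 0 := by
    intro χ hχ
    -- With separated test functions, the time derivative and endpoint terms agree for `v` and `w`
    -- and cancel. What remains is `∫ χ m = 0` for every smooth `χ`, so `m` vanishes almost
    -- everywhere.
    let Φ : ℝ × V d → ℝ := fun p => χ p.1 * f p.2
    have hΦ : ContDiff ℝ 1 Φ :=
      ((hχ.of_le (by norm_num)).comp contDiff_fst).mul (hfC.comp contDiff_snd)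
    have hΦd : ∀ t x u, fderiv ℝ Φ (t, x) (0, u) = χ t * inner ℝ (k x) u := by
      intro t x u
      have h1 : HasFDerivAt (fun y => Φ (t, y)) (χ t • InnerProductSpace.toDual ℝ (V d) (k x)) x :=
        (hf x).hasFDerivAt.const_mul (χ t)
      have h2 : HasFDerivAt (fun y => Φ (t, y))
          ((fderiv ℝ Φ (t, x)).comp (ContinuousLinearMap.inr ℝ ℝ (V d))) x :=
        (hΦ.differentiable one_ne_zero (t, x)).hasFDerivAt.comp x (hasFDerivAt_prodMk_right t x)
      have h3 := congr($(h2.unique h1) u)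
      simpa using h3
    have hcv := hv.2.2 Φ hΦ
    have hcw := (h.mem_CE hΩ).2.2 Φ hΦ
    rw [← hcw, add_left_cancel_iff] at hcv
    simp only [hΦd] at hcv
    have hmeas : ∀ {u : ℝ → V d → V d}, Measurable (fun p : ℝ × V d => u p.1 p.2) →
        Measurable (fun p : ℝ × V d => χ p.1 * inner ℝ (k p.2) (u p.1 p.2)) := fun hu =>
      (hχ.continuous.measurable.comp measurable_fst).mul
        ((hk.measurable.comp measurable_snd).inner hu)
    have e1 := h.integral_eq (hmeas hv.1)
    have e2 := h.integral_eq (hmeas h.measurable_field)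
    simp only at e1 e2
    rw [e1, e2] at hcv
    simp only [integral_const_mul] at hcv
    have hprod : ∀ {n : ℝ → ℝ}, Integrable n (volume.restrict (Icc (0 : ℝ) 1)) →
        Integrable (fun t => χ t * n t) (volume.restrict (Icc (0 : ℝ) 1)) := by
      intro n hn
      obtain ⟨D, hD⟩ := (isCompact_Icc (a := (0 : ℝ)) (b := 1)).exists_bound_of_continuousOn
        hχ.continuous.continuousOn
      exact hn.bdd_mul (c := D) hχ.continuous.aestronglyMeasurable
        ((ae_restrict_mem measurableSet_Icc).mono fun t ht => hD t ht)
    have hiv := integrable_inner hv2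
    have hiw := integrable_inner hw2
    rw [← sub_eq_zero, ← integral_sub (hprod hiv.integral_prod_left)
      (hprod hiw.integral_prod_left)] at hcv
    refine Eq.trans ?_ hcv
    refine integral_congr_ae ?_
    filter_upwards [hiv.prod_right_ae, hiw.prod_right_ae] with t h1 h2
    rw [← mul_sub]
    simp only [m, inner_sub_right]
    rw [integral_sub h1 h2]
  have hloc : LocallyIntegrable ((Icc (0 : ℝ) 1).indicator m) volume :=
    ((integrable_indicator_iff measurableSet_Icc).2 hm).locallyIntegrable
  have hsmul : ∀ χ : ℝ → ℝ, ContDiff ℝ ∞ χ → HasCompactSupport χ →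
      ∫ t, χ t • (Icc (0 : ℝ) 1).indicator m t = 0 := fun χ hχ _ => by
    refine Eq.trans ?_ (htest χ hχ)
    rw [← integral_indicator measurableSet_Icc]
    congr 1
    ext t
    by_cases ht : t ∈ Icc (0 : ℝ) 1
    · rw [indicator_of_mem ht, indicator_of_mem ht, smul_eq_mul]
    · rw [indicator_of_notMem ht, indicator_of_notMem ht, smul_zero]
  have := ae_eq_zero_of_integral_contDiff_smul_eq_zero hloc hsmul
  rw [ae_restrict_iff' measurableSet_Icc]
  filter_upwards [this] with t ht ht1
  rwa [indicator_of_mem ht1] at ht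

/-- A limit of piecewise constant gradient fields has minimal kinetic energy. -/
lemma kinetic_le_of_mem_CE (h : IsTransport A w φ ρ) (hΩ : IsCompact Ω)
    {g : ℕ → ℤ → V d → V d} (hg : IsStepLimit A g w) {v : ℝ → V d → V d} (hv : v ∈ CE ρ) :
    ∫⁻ t in Icc (0 : ℝ) 1, ∫⁻ x, ‖w t x‖ₑ ^ 2 ∂(ρ t).1 ≤
      ∫⁻ t in Icc (0 : ℝ) 1, ∫⁻ x, ‖v t x‖ₑ ^ 2 ∂(ρ t).1 := by
  set ν := (volume.restrict (Icc (0 : ℝ) 1)).prod (ρ 0).1 with hν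
  have hsq : Measurable fun p : ℝ × V d => ‖w p.1 p.2‖ₑ ^ 2 := h.measurable_field.enorm.pow_const 2
  have hsqv : Measurable fun p : ℝ × V d => ‖v p.1 p.2‖ₑ ^ 2 := hv.1.enorm.pow_const 2
  rw [h.lintegral_eq hsq, h.lintegral_eq hsqv]
  let Vf : ℝ × V d → V d := fun p => v p.1 (φ p.1 p.2)
  let Wf : ℝ × V d → V d := fun p => w p.1 (φ p.1 p.2)
  have hVm : Measurable Vf := hv.1.comp h.measurable_pair
  have hWm : Measurable Wf := h.measurable_field.comp h.measurable_pair
  change ∫⁻ p, ‖Wf p‖ₑ ^ 2 ∂ν ≤ ∫⁻ p, ‖Vf p‖ₑ ^ 2 ∂ν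
  -- Membership in `CE` gives square integrability only at each fixed time. Finite total energy
  -- supplies it in space-time.
  by_cases htop : ∫⁻ p, ‖Vf p‖ₑ ^ 2 ∂ν = ⊤
  · rw [htop]; exact le_top
  have hV2 : MemLp Vf 2 ν := by
    refine ⟨hVm.aestronglyMeasurable, ?_⟩
    rw [eLpNorm_lt_top_iff_lintegral_rpow_enorm_lt_top (by norm_num) (by norm_num)]
    simpa using lt_top_iff_ne_top.2 htop
  have hW2 : MemLp Wf 2 ν := MemLp.of_bound hWm.aestronglyMeasurable A
    (Eventually.of_forall fun p => h.bound _ _)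
  have hU2 : MemLp (Vf - Wf) 2 ν := hV2.sub hW2
  have hU1 : Integrable (Vf - Wf) ν := hU2.integrable (by norm_num)
  have horth : ∫ p, inner ℝ (Wf p) ((Vf - Wf) p) ∂ν = 0 := by
    let G : ℕ → ℝ × V d → V d := fun n p => g n ⌊(n : ℝ) * p.1⌋ (φ p.1 p.2)
    have hGm : ∀ n, Measurable (G n) := fun n => by
      have h1 : Measurable (fun q : ℤ × V d => g n q.1 q.2) :=
        measurable_from_prod_countable_right fun k => (hg.lipschitz n k).continuous.measurable
      exact h1.comp ((Int.measurable_floor.comp (measurable_fst.const_mul _)).prodMk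
        h.measurable_flow)
    have hGint : ∀ n, Integrable (fun p => inner ℝ (G n p) ((Vf - Wf) p)) ν := fun n =>
      (hU1.norm.const_mul (A : ℝ)).mono' ((hGm n).aestronglyMeasurable.inner hU1.1)
        (Eventually.of_forall fun p => (norm_inner_le_norm _ _).trans (by
          gcongr; exact hg.bound _ _ _))
    have hzero : ∀ n, ∫ p, inner ℝ (G n p) ((Vf - Wf) p) ∂ν = 0 := by
      intro n
      rw [hν, integral_prod _ (hGint n)]
      -- There are countably many `k`, so one null set of times serves all pieces, and the index may
      -- then depend on `t`.
      have hall : ∀ᵐ t ∂(volume.restrict (Icc (0 : ℝ) 1)), ∀ k : ℤ,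
          ∫ x, inner ℝ (g n k (φ t x)) (v t (φ t x) - w t (φ t x)) ∂(ρ 0).1 = 0 := by
        rw [ae_all_iff]
        intro k
        obtain ⟨f, hf⟩ := hg.gradient n k
        exact h.ae_integral_inner_eq_zero hΩ hv (hV2.integrable (by norm_num)) hf
          (hg.lipschitz n k).continuous ⟨A, hg.bound n k⟩
      refine (integral_congr_ae ?_).trans (integral_zero _ _)
      filter_upwards [hall] with t ht
      exact ht ⌊(n : ℝ) * t⌋
    have hlim : Tendsto (fun n => ∫ p, inner ℝ (G n p) ((Vf - Wf) p) ∂ν) atTop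
        (𝓝 (∫ p, inner ℝ (Wf p) ((Vf - Wf) p) ∂ν)) := by
      refine tendsto_integral_of_dominated_convergence (fun p => A * ‖(Vf - Wf) p‖)
        (fun n => (hGint n).1) (hU1.norm.const_mul _) (fun n => Eventually.of_forall fun p =>
          (norm_inner_le_norm _ _).trans (by gcongr; exact hg.bound _ _ _)) ?_
      have h1 : ∀ᵐ t ∂(volume.restrict (Icc (0 : ℝ) 1)), ∀ x,
          Tendsto (fun n : ℕ => g n ⌊(n : ℝ) * t⌋ x) atTop (𝓝 (w t x)) :=
        (ae_restrict_iff' measurableSet_Icc).2 hg.tendsto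
      filter_upwards [Measure.quasiMeasurePreserving_fst.ae h1] with p hp
      exact (hp _).inner tendsto_const_nhds
    simp only [hzero] at hlim
    exact tendsto_nhds_unique hlim tendsto_const_nhds
  have := lintegral_sq_le_of_orthogonal hW2 hU2 horth
  simpa using this

/-- The energy of a transported curve whose field is a limit of gradient fields. -/
lemma energy_eq (h : IsTransport A w φ ρ) (hΩ : IsCompact Ω)
    {g : ℕ → ℤ → V d → V d} (hg : IsStepLimit A g w) :
    energy ρ = ∫⁻ t in Icc (0 : ℝ) 1, ∫⁻ x, ‖w t x‖ₑ ^ 2 ∂(ρ t).1 :=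
  le_antisymm (iInf₂_le w (h.mem_CE hΩ))
    (le_iInf₂ fun _ hv => h.kinetic_le_of_mem_CE hΩ hg hv)

end IsTransport

/-! ### Energies of curves in `S` and of their images in `Λ`. -/

section Energy

set_option linter.unusedSectionVars false

variable {F : Type*} [NormedAddCommGroup F] [NormedSpace ℝ F]
  {H : Type*} [TopologicalSpace H] {I : ModelWithCorners ℝ F H}
  {S : Type*} [MetricSpace S] [ChartedSpace H S] [IsManifold I ∞ S]
  [RiemannianBundle (fun x : S => TangentSpace I x)] {d : ℕ} {Ω : Set (V d)}

namespace Model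

lemma E_injective (M : Model I S Ω) : Function.Injective M.E := by
  obtain ⟨C, -, h⟩ := M.E_bilipschitz
  intro θ θ' hE
  have h1 := (h θ θ').2
  have h2 := (h θ' θ').1
  rw [edist_self, mul_zero, nonpos_iff_eq_zero] at h2
  rw [hE, h2, mul_zero, nonpos_iff_eq_zero] at h1
  exact edist_eq_zero.1 h1

variable [IsContMDiffRiemannianBundle I ∞ F (fun x : S => TangentSpace I x)]
  [IsRiemannianManifold I S] [FiniteDimensional ℝ F]

/-- The energy of a Lipschitz curve in `S`, compared with the energy of its image. -/
lemma exists_energy_estimates (M : Model I S Ω) (hΩ : IsCompact Ω) :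
    ∃ C : ℝ≥0, 0 < C ∧ ∀ (γ : ℝ → S) (L : ℝ≥0), LipschitzOnWith L γ (Icc 0 1) →
      ∀ ρ : ℝ → ProbOn Ω, (∀ t ∈ Icc (0 : ℝ) 1, ρ t = M.E (γ t)) →
        energy ρ = M.energyS γ ∧ W (ρ 0) (ρ 1) ≤ M.energyS γ ^ (1 / 2 : ℝ) ∧
          M.energyS γ ≤ (C * L : ℝ≥0) ^ 2 := by
  obtain ⟨C, hC, hstep⟩ := M.exists_isStepLimit
  refine ⟨C, hC, fun γ L hγ ρ hρ => ?_⟩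
  obtain ⟨g, hg⟩ := hstep γ L hγ
  obtain ⟨w, hwm, hwb, hwl, hw⟩ := hg.exists_measurable
  obtain ⟨φ, hφm, hφ⟩ := exists_flow hwm hwb hwl
  -- The measurable version `w` agrees with `B_{γ(t)} γ'(t)` at almost every time. Its flow solves
  -- the same integral equation, so the consistency hypothesis applies to it.
  have hflow : IsFlow Ω (fun t => M.B (γ t) (velocity I γ t)) φ := by
    intro x _
    have hm : Measurable fun s => w s (φ s x) :=
      hwm.comp (measurable_id.prodMk (hφm.comp (measurable_id.prodMk measurable_const)))
    have hae : ∀ t ∈ Icc (0 : ℝ) 1, ∀ᵐ s, s ∈ uIoc 0 t →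
        w s (φ s x) = M.B (γ s) (velocity I γ s) (φ s x) := by
      intro t ht
      filter_upwards [hw] with s hs hst
      rw [uIoc_of_le ht.1] at hst
      rw [hs ⟨hst.1.le, hst.2.trans ht.2⟩]
    constructor
    · refine (intervalIntegrable_of_bound hm (fun s => hwb _ _) 0 1).congr_ae ?_
      exact (ae_restrict_iff' measurableSet_uIoc).2 (hae 1 (by simp))
    · intro t ht
      rw [hφ x t ht, intervalIntegral.integral_congr_ae (hae t ht)]
  have hpush := M.consistent γ ⟨L, hγ⟩ φ hflow
  have htr : IsTransport (C * L) w φ ρ := by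
    refine ⟨hwm, hwb, hwl, hφm, hφ, fun t ht => ?_⟩
    rw [hρ t ht, hρ 0 (by simp)]
    exact hpush t ht
  have hE : M.energyS γ = ∫⁻ t in Icc (0 : ℝ) 1, ∫⁻ x, ‖w t x‖ₑ ^ 2 ∂(ρ t).1 := by
    refine lintegral_congr_ae ((ae_restrict_iff' measurableSet_Icc).2 ?_)
    filter_upwards [hw] with t ht ht1
    rw [ht ht1, hρ t ht1]
  rw [hE]
  refine ⟨htr.energy_eq hΩ (hg.congr hw), htr.W_le, ?_⟩
  have hb : ∀ t x, ‖w t x‖ₑ ≤ ((C * L : ℝ≥0) : ℝ≥0∞) := fun t x => by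
    rw [enorm_le_coe]; exact hwb t x
  calc _ ≤ ∫⁻ t in Icc (0 : ℝ) 1, ∫⁻ _, ((C * L : ℝ≥0) : ℝ≥0∞) ^ 2 ∂(ρ t).1 := by
        gcongr; exact hb _ _
    _ = _ := by simp

/-- `d_Λ` is given by the energies of Lipschitz curves in `S`. -/
lemma dLam_eq (M : Model I S Ω) (hΩ : IsCompact Ω) (θ₀ θ₁ : S) :
    M.dLam θ₀ θ₁ = ⨅ γ ∈ {γ : ℝ → S | IsLipPath γ ∧ γ 0 = θ₀ ∧ γ 1 = θ₁},
      M.energyS γ ^ (1 / 2 : ℝ) := by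
  obtain ⟨C, -, hest⟩ := M.exists_energy_estimates hΩ
  obtain ⟨K, -, hK⟩ := M.E_bilipschitz
  apply le_antisymm
  · refine le_iInf₂ fun γ hγ => ?_
    obtain ⟨⟨L, hL⟩, rfl, rfl⟩ := hγ
    rw [← (hest γ L hL (fun t => M.E (γ t)) fun t _ => rfl).1]
    refine iInf₂_le (fun t => M.E (γ t)) ⟨⟨K * L, fun s hs t ht => ?_⟩, fun t _ => ⟨_, rfl⟩, rfl, rfl⟩
    refine (hK _ _).1.trans ?_
    rw [ENNReal.coe_mul, mul_assoc]
    gcongr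
    exact hL hs ht
  · refine le_iInf₂ fun ρ hρ => ?_
    obtain ⟨⟨L, hL⟩, hΛ, h0, h1⟩ := hρ
    have : Nonempty S := ⟨θ₀⟩
    -- The curve is lifted through `E` on `[0,1]`, with arbitrary values elsewhere; the lower
    -- bi-Lipschitz bound makes the lift Lipschitz.
    choose! γ hγ using hΛ
    have hLip : LipschitzOnWith (K * L) γ (Icc 0 1) := by
      intro s hs t ht
      refine (hK _ _).2.trans ?_
      rw [hγ s hs, hγ t ht, ENNReal.coe_mul, mul_assoc]
      gcongr
      exact hL s hs t ht
    rw [(hest γ _ hLip ρ fun t ht => (hγ t ht).symm).1]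
    refine iInf₂_le γ ⟨⟨_, hLip⟩, M.E_injective ?_, M.E_injective ?_⟩
    · rw [hγ 0 (by simp), h0]
    · rw [hγ 1 (by simp), h1]

/-- `d_Λ` and `W` (along `E`) and the Riemannian distance are comparable. -/
lemma exists_dLam_bounds (M : Model I S Ω) (hΩ : IsCompact Ω) :
    ∃ C : ℝ≥0, 0 < C ∧ ∀ θ₀ θ₁,
      M.dLam θ₀ θ₁ ≤ C * edist θ₀ θ₁ ∧ W (M.E θ₀) (M.E θ₁) ≤ M.dLam θ₀ θ₁ := by
  obtain ⟨C, hC, hest⟩ := M.exists_energy_estimates hΩ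
  refine ⟨C, hC, fun θ₀ θ₁ => ⟨?_, ?_⟩⟩
  · obtain ⟨η, hη, rfl⟩ := M.D_joins θ₀ θ₁
    have h0 := (M.isGeodesicFrom_expCurve hη).zero
    -- The competitor is a minimizing geodesic, whose Lipschitz constant `‖η‖` equals the distance
    -- of its endpoints.
    have hLip : LipschitzOnWith ‖η‖₊ (expCurve I θ₀ η) (Icc 0 1) := by
      refine LipschitzOnWith.of_dist_le_mul fun s hs t ht => ?_
      rcases le_total s t with h | h
      · rw [Real.dist_eq, abs_sub_comm, abs_of_nonneg (by linarith)]
        exact M.dist_expCurve_le hη hs.1 h ht.2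
      · rw [dist_comm, Real.dist_eq, abs_of_nonneg (by linarith)]
        exact M.dist_expCurve_le hη ht.1 h hs.2
    have h1 := (hest _ _ hLip _ fun t _ => rfl).2.2
    rw [M.dLam_eq hΩ]
    refine (iInf₂_le _ ⟨⟨_, hLip⟩, h0, rfl⟩).trans ?_
    refine (ENNReal.rpow_le_rpow h1 (by norm_num)).trans (le_of_eq ?_)
    rw [← ENNReal.rpow_natCast, ← ENNReal.rpow_mul, edist_dist, ← M.D_dist θ₀ η hη,
      ofReal_norm, enorm_eq_nnnorm]
    norm_num
  · rw [M.dLam_eq hΩ]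
    refine le_iInf₂ fun γ hγ => ?_
    obtain ⟨⟨L, hL⟩, rfl, rfl⟩ := hγ
    exact (hest γ L hL (fun t => M.E (γ t)) fun t _ => rfl).2.1

end Model

end Energy

/-! ### Reversal and concatenation: symmetry and the triangle inequality. -/

section Reparametrization

set_option linter.unusedSectionVars false

variable {F : Type*} [NormedAddCommGroup F] [NormedSpace ℝ F]
  {H : Type*} [TopologicalSpace H] {I : ModelWithCorners ℝ F H}
  {S : Type*} [MetricSpace S] [ChartedSpace H S] [IsManifold I ∞ S]
  [RiemannianBundle (fun x : S => TangentSpace I x)] {d : ℕ} {Ω : Set (V d)}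

/-- Differentiability is inherited by affine reparametrizations. -/
lemma hasMFDerivAt_comp_affine {γ σ : ℝ → S} {c b t : ℝ}
    (hσ : σ =ᶠ[𝓝 t] fun s => γ (c * s + b)) (hγ : MDifferentiableAt 𝓘(ℝ, ℝ) I γ (c * t + b)) :
    HasMFDerivAt 𝓘(ℝ, ℝ) I σ t
      ((mfderiv 𝓘(ℝ, ℝ) I γ (c * t + b) : ℝ →L[ℝ] F).comp (c • ContinuousLinearMap.id ℝ ℝ)) := by
  have h1 : HasDerivAt (fun s : ℝ => c * s + b) c t := by
    simpa using ((hasDerivAt_id t).const_mul c).add_const b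
  have h2 : HasMFDerivAt 𝓘(ℝ, ℝ) 𝓘(ℝ, ℝ) (fun s : ℝ => c * s + b) t
      (c • ContinuousLinearMap.id ℝ ℝ : ℝ →L[ℝ] ℝ) := by
    refine HasFDerivAt.hasMFDerivAt ?_
    have h3 : (c • ContinuousLinearMap.id ℝ ℝ : ℝ →L[ℝ] ℝ) =
        ContinuousLinearMap.toSpanSingleton ℝ c := by
      ext
      simp
    exact h3 ▸ h1.hasFDerivAt
  exact (hγ.hasMFDerivAt.comp t h2).congr_of_eventuallyEq hσ

/-- The velocity of an affine reparametrization. -/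
lemma velocity_comp_affine {γ σ : ℝ → S} {c b t : ℝ} (hc : c ≠ 0)
    (hσ : σ =ᶠ[𝓝 t] fun s => γ (c * s + b)) (ht : t ∈ Ioo (0 : ℝ) 1)
    (hct : c * t + b ∈ Ioo (0 : ℝ) 1) :
    (velocity I σ t : F) = c • (velocity I γ (c * t + b) : F) := by
  unfold velocity
  rw [mfderivWithin_of_mem_nhds (Icc_mem_nhds ht.1 ht.2),
    mfderivWithin_of_mem_nhds (Icc_mem_nhds hct.1 hct.2)]
  by_cases hγ : MDifferentiableAt 𝓘(ℝ, ℝ) I γ (c * t + b)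
  · rw [(hasMFDerivAt_comp_affine hσ hγ).mfderiv]
    exact ((mfderiv 𝓘(ℝ, ℝ) I γ (c * t + b) : ℝ →L[ℝ] F).map_smul c (1 : ℝ))
  -- The inverse affine map would carry differentiability of `σ` back to `γ`; so where `γ` is not
  -- differentiable both velocities take the default value zero.
  · have hσ' : ¬ MDifferentiableAt 𝓘(ℝ, ℝ) I σ t := by
      intro h
      have ht' : c⁻¹ * (c * t + b) + -(c⁻¹ * b) = t := by field_simp; ring
      have hcont : Tendsto (fun s => c⁻¹ * s + -(c⁻¹ * b)) (𝓝 (c * t + b)) (𝓝 t) := by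
        refine Continuous.tendsto' (by fun_prop) _ _ ht'
      have hev : γ =ᶠ[𝓝 (c * t + b)] fun s => σ (c⁻¹ * s + -(c⁻¹ * b)) := by
        filter_upwards [hcont.eventually hσ] with s hs
        rw [hs]
        congr 1
        field_simp
        ring
      exact hγ (hasMFDerivAt_comp_affine hev (ht'.symm ▸ h)).mdifferentiableAt
    rw [mfderiv_zero_of_not_mdifferentiableAt hγ, mfderiv_zero_of_not_mdifferentiableAt hσ']
    exact (smul_zero c).symm

namespace Model

/-- Every tangent space is definitionally `F`, so vectors over equal base points can be compared
there without transport. -/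
lemma B_congr (M : Model I S Ω) {θ θ' : S} (h : θ = θ') {u : TangentSpace I θ}
    {v : TangentSpace I θ'} (huv : (u : F) = (v : F)) : M.B θ u = M.B θ' v := by
  subst h
  exact congrArg _ huv

/-- The part of the energy of a curve that comes from an affine reparametrization. -/
lemma lintegral_comp_affine_le (M : Model I S Ω) {γ σ : ℝ → S} {c b p q : ℝ} (hc : c ≠ 0)
    (hpq : Ioo p q ⊆ Ioo (0 : ℝ) 1) (h : ∀ t ∈ Ioo p q, c * t + b ∈ Ioo (0 : ℝ) 1)
    (hσ : ∀ t ∈ Ioo p q, σ t = γ (c * t + b)) :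
    ∫⁻ t in Ioo p q, ∫⁻ x, ‖M.B (σ t) (velocity I σ t) x‖ₑ ^ 2 ∂(M.E (σ t)).1 ≤
      ENNReal.ofReal |c| * M.energyS γ := by
  set g : ℝ → ℝ≥0∞ := fun s => ∫⁻ x, ‖M.B (γ s) (velocity I γ s) x‖ₑ ^ 2 ∂(M.E (γ s)).1 with hg
  -- Speeding up by `c` multiplies the integrand by `c²`. One factor `|c|` is kept apart to serve as
  -- the Jacobian of the substitution.
  have hfg : ∀ t ∈ Ioo p q, ∫⁻ x, ‖M.B (σ t) (velocity I σ t) x‖ₑ ^ 2 ∂(M.E (σ t)).1 =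
      ENNReal.ofReal |c| * (ENNReal.ofReal |c| * g (c * t + b)) := by
    intro t ht
    have hev : σ =ᶠ[𝓝 t] fun s => γ (c * s + b) := by
      filter_upwards [Ioo_mem_nhds ht.1 ht.2] with s hs using hσ s hs
    have hB : M.B (σ t) (velocity I σ t) = c • M.B (γ (c * t + b)) (velocity I γ (c * t + b)) := by
      rw [← map_smul]
      exact M.B_congr (hσ t ht) (velocity_comp_affine hc hev (hpq ht) (h t ht))
    have hc' : ‖c‖ₑ = ENNReal.ofReal |c| := by rw [← Real.norm_eq_abs, ofReal_norm]
    rw [hB, hσ t ht, ← mul_assoc, ← pow_two, hg, ← lintegral_const_mul' _ _ (by simp), ← hc']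
    simp only [Pi.smul_apply, enorm_smul, mul_pow]
  have hderiv : ∀ t ∈ Ioo p q, HasDerivWithinAt (fun s : ℝ => c * s + b) c (Ioo p q) t :=
    fun t _ => by simpa using (((hasDerivAt_id t).const_mul c).add_const b).hasDerivWithinAt
  have hinj : InjOn (fun s : ℝ => c * s + b) (Ioo p q) := fun s _ t _ hst =>
    mul_left_cancel₀ hc (add_right_cancel hst)
  rw [setLIntegral_congr_fun measurableSet_Ioo hfg, lintegral_const_mul' _ _ (by simp),
    ← lintegral_image_eq_lintegral_abs_deriv_mul measurableSet_Ioo hderiv hinj]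
  gcongr
  refine lintegral_mono_set ?_
  rintro _ ⟨t, ht, rfl⟩
  exact Ioo_subset_Icc_self (h t ht)

lemma energyS_reverse_le (M : Model I S Ω) (γ : ℝ → S) :
    M.energyS (fun t => γ (1 - t)) ≤ M.energyS γ := by
  unfold energyS
  conv_lhs => rw [Measure.restrict_congr_set Ioo_ae_eq_Icc.symm]
  refine (M.lintegral_comp_affine_le (γ := γ) (c := -1) (b := 1) (by norm_num) subset_rfl
    (fun t ht => ⟨by linarith [ht.2], by linarith [ht.1]⟩)
    fun t _ => by congr 1; ring).trans ?_
  simp [energyS]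

/-- Curves from `θ₀` to `θ₁` and from `θ₁` to `θ₂` can be concatenated, and their lengths add
up. -/
lemma exists_concat (M : Model I S Ω) {γ₁ γ₂ : ℝ → S} (h₁ : IsLipPath γ₁) (h₂ : IsLipPath γ₂)
    (h : γ₁ 1 = γ₂ 0) {a b : ℝ} (ha : 0 < a) (hb : 0 < b)
    (hE₁ : M.energyS γ₁ ≤ ENNReal.ofReal a ^ 2) (hE₂ : M.energyS γ₂ ≤ ENNReal.ofReal b ^ 2) :
    ∃ σ : ℝ → S, IsLipPath σ ∧ σ 0 = γ₁ 0 ∧ σ 1 = γ₂ 1 ∧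
      M.energyS σ ≤ ENNReal.ofReal (a + b) ^ 2 := by
  obtain ⟨L₁, hL₁⟩ := h₁
  obtain ⟨L₂, hL₂⟩ := h₂
  have hab : 0 < a + b := by linarith
  -- Time is shared in proportion to the length bounds `a` and `b`, since `a² / τ + b² / (1 - τ)` is
  -- then exactly `(a + b)²`.
  set τ : ℝ := a / (a + b) with hτ
  have hτ0 : 0 < τ := div_pos ha hab
  have hτ1 : τ < 1 := (div_lt_one hab).2 (by linarith)
  set c₁ : ℝ := (a + b) / a with hc₁
  set c₂ : ℝ := (a + b) / b with hc₂
  have hc₁0 : 0 < c₁ := div_pos hab ha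
  have hc₂0 : 0 < c₂ := div_pos hab hb
  have e₁ : c₁ * τ = 1 := by rw [hc₁, hτ]; field_simp
  have e₂ : c₂ * (1 - τ) = 1 := by rw [hc₂, hτ]; field_simp; ring
  set σ : ℝ → S := fun t => if t ≤ τ then γ₁ (c₁ * t + 0) else γ₂ (c₂ * t + -(c₂ * τ)) with hσ
  have hσ₁ : ∀ t ≤ τ, σ t = γ₁ (c₁ * t + 0) := fun t ht => if_pos ht
  have hσ₂ : ∀ t, τ ≤ t → σ t = γ₂ (c₂ * t + -(c₂ * τ)) := by
    intro t ht
    rcases ht.eq_or_lt with rfl | ht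
    · rw [hσ₁ _ le_rfl, add_zero, e₁, h]
      congr 1
      ring
    · exact if_neg ht.not_ge
  have m₁ : ∀ t, 0 ≤ t → t ≤ τ → c₁ * t + 0 ∈ Icc (0 : ℝ) 1 := fun t h0 h1 =>
    ⟨by positivity, by rw [add_zero, ← e₁]; gcongr⟩
  have m₂ : ∀ t, τ ≤ t → t ≤ 1 → c₂ * t + -(c₂ * τ) ∈ Icc (0 : ℝ) 1 := fun t h0 h1 =>
    ⟨by nlinarith, by nlinarith⟩
  have d₁ : ∀ s t, 0 ≤ s → s ≤ t → t ≤ τ → dist (σ s) (σ t) ≤ L₁ * c₁ * (t - s) := by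
    intro s t h0 hst ht
    rw [hσ₁ s (hst.trans ht), hσ₁ t ht]
    refine (hL₁.dist_le_mul _ (m₁ s h0 (hst.trans ht)) _ (m₁ t (h0.trans hst) ht)).trans ?_
    rw [Real.dist_eq, abs_sub_comm, abs_of_nonneg (by nlinarith)]
    exact le_of_eq (by ring)
  have d₂ : ∀ s t, τ ≤ s → s ≤ t → t ≤ 1 → dist (σ s) (σ t) ≤ L₂ * c₂ * (t - s) := by
    intro s t h0 hst ht
    rw [hσ₂ s h0, hσ₂ t (h0.trans hst)]
    refine (hL₂.dist_le_mul _ (m₂ s h0 (hst.trans ht)) _ (m₂ t (h0.trans hst) ht)).trans ?_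
    rw [Real.dist_eq, abs_sub_comm, abs_of_nonneg (by nlinarith)]
    exact le_of_eq (by ring)
  have n₁ : 0 ≤ (L₁ : ℝ) * c₁ := by positivity
  have n₂ : 0 ≤ (L₂ : ℝ) * c₂ := by positivity
  have d₃ : ∀ s t, 0 ≤ s → s ≤ t → t ≤ 1 →
      dist (σ s) (σ t) ≤ (L₁ * c₁ + L₂ * c₂) * (t - s) := by
    intro s t h0 hst h1
    rcases le_total t τ with ht | ht
    · refine (d₁ s t h0 hst ht).trans ?_
      nlinarith [mul_nonneg n₂ (sub_nonneg.2 hst)]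
    rcases le_total τ s with hs | hs
    · refine (d₂ s t hs hst h1).trans ?_
      nlinarith [mul_nonneg n₁ (sub_nonneg.2 hst)]
    · refine (dist_triangle _ (σ τ) _).trans
        ((add_le_add (d₁ s τ h0 hs le_rfl) (d₂ τ t le_rfl ht h1)).trans ?_)
      nlinarith [mul_nonneg n₁ (sub_nonneg.2 ht), mul_nonneg n₂ (sub_nonneg.2 hs)]
  refine ⟨σ, ⟨⟨L₁ * c₁ + L₂ * c₂, add_nonneg n₁ n₂⟩,
    LipschitzOnWith.of_dist_le_mul fun s hs t ht => ?_⟩, ?_, ?_, ?_⟩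
  · rcases le_total s t with hst | hst
    · rw [Real.dist_eq, abs_sub_comm, abs_of_nonneg (by linarith)]
      exact d₃ s t hs.1 hst ht.2
    · rw [dist_comm, Real.dist_eq, abs_of_nonneg (by linarith)]
      exact d₃ t s ht.1 hst hs.2
  · rw [hσ₁ 0 hτ0.le]; simp
  · rw [hσ₂ 1 hτ1.le]
    congr 1
    linarith
  · have hs₁ := M.lintegral_comp_affine_le (γ := γ₁) (σ := σ) (c := c₁) (b := 0) (p := 0) (q := τ)
      hc₁0.ne' (Ioo_subset_Ioo_right hτ1.le)
      (fun t ht => ⟨by rw [add_zero]; exact mul_pos hc₁0 ht.1, by nlinarith [ht.2]⟩)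
      fun t ht => hσ₁ t ht.2.le
    have hs₂ := M.lintegral_comp_affine_le (γ := γ₂) (σ := σ) (c := c₂) (b := -(c₂ * τ)) (p := τ)
      (q := 1) hc₂0.ne' (Ioo_subset_Ioo_left hτ0.le)
      (fun t ht => ⟨by nlinarith [ht.1], by nlinarith [ht.2]⟩)
      fun t ht => hσ₂ t ht.1.le
    unfold energyS at hs₁ hs₂ hE₁ hE₂ ⊢
    rw [Measure.restrict_congr_set Ioo_ae_eq_Icc, abs_of_pos hc₁0] at hs₁
    rw [Measure.restrict_congr_set Ioo_ae_eq_Icc, abs_of_pos hc₂0] at hs₂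
    rw [← Icc_union_Icc_eq_Icc hτ0.le hτ1.le]
    refine (lintegral_union_le _ _ _).trans ((add_le_add hs₁ hs₂).trans ?_)
    refine (add_le_add (mul_le_mul_right hE₁ _) (mul_le_mul_right hE₂ _)).trans (le_of_eq ?_)
    rw [← ENNReal.ofReal_pow ha.le, ← ENNReal.ofReal_pow hb.le, ← ENNReal.ofReal_pow hab.le,
      ← ENNReal.ofReal_mul hc₁0.le, ← ENNReal.ofReal_mul hc₂0.le,
      ← ENNReal.ofReal_add (by positivity) (by positivity)]
    congr 1
    rw [hc₁, hc₂]
    field_simp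

variable [IsContMDiffRiemannianBundle I ∞ F (fun x : S => TangentSpace I x)]
  [IsRiemannianManifold I S] [FiniteDimensional ℝ F]

lemma dLam_comm (M : Model I S Ω) (hΩ : IsCompact Ω) (θ₀ θ₁ : S) :
    M.dLam θ₀ θ₁ = M.dLam θ₁ θ₀ := by
  have key : ∀ θ₀ θ₁ : S, M.dLam θ₀ θ₁ ≤ M.dLam θ₁ θ₀ := by
    intro θ₀ θ₁
    rw [M.dLam_eq hΩ, M.dLam_eq hΩ]
    refine le_iInf₂ fun γ hγ => ?_
    obtain ⟨⟨L, hL⟩, rfl, rfl⟩ := hγ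
    refine (iInf₂_le (fun t => γ (1 - t)) ⟨⟨L, fun s hs t ht => ?_⟩, by simp, by simp⟩).trans
      (ENNReal.rpow_le_rpow (M.energyS_reverse_le γ) (by norm_num))
    refine (hL ⟨by linarith [hs.2], by linarith [hs.1]⟩
      ⟨by linarith [ht.2], by linarith [ht.1]⟩).trans (le_of_eq ?_)
    rw [edist_dist, edist_dist, Real.dist_eq, Real.dist_eq, abs_sub_comm]
    congr 3
    ring_nf
  exact le_antisymm (key _ _) (key _ _)

lemma dLam_triangle (M : Model I S Ω) (hΩ : IsCompact Ω) (θ₀ θ₁ θ₂ : S) :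
    M.dLam θ₀ θ₂ ≤ M.dLam θ₀ θ₁ + M.dLam θ₁ θ₂ := by
  rw [M.dLam_eq hΩ θ₀ θ₁, M.dLam_eq hΩ θ₁ θ₂]
  refine ENNReal.le_iInf₂_add_iInf₂ fun γ₁ h₁ γ₂ h₂ => ?_
  obtain ⟨hL₁, rfl, rfl⟩ := h₁
  obtain ⟨hL₂, h, rfl⟩ := h₂
  set x := M.energyS γ₁ ^ (1 / 2 : ℝ) with hx
  set y := M.energyS γ₂ ^ (1 / 2 : ℝ) with hy
  refine ENNReal.le_of_forall_pos_le_add fun ε hε hxy => ?_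
  have hxt : x ≠ ⊤ := (ENNReal.add_lt_top.1 hxy).1.ne
  have hyt : y ≠ ⊤ := (ENNReal.add_lt_top.1 hxy).2.ne
  have hsq : ∀ z : ℝ≥0∞, (z ^ (1 / 2 : ℝ)) ^ 2 = z := fun z => by
    rw [← ENNReal.rpow_natCast, ← ENNReal.rpow_mul]; norm_num
  have hle : ∀ z : ℝ≥0∞, z ≠ ⊤ → z ≤ ENNReal.ofReal (z.toReal + ε / 2) := fun z hz =>
    ENNReal.le_ofReal_iff_toReal_le hz (by positivity) |>.2 (by
      have : (0 : ℝ) < ε := hε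
      linarith)
  have hε' : (0 : ℝ) < ε := hε
  -- Adding `ε / 2` makes both length bounds positive, as the time sharing requires, even if one
  -- curve has zero energy.
  obtain ⟨σ, hσ, h0, h1, hE⟩ := M.exists_concat hL₁ hL₂ h.symm (a := x.toReal + ε / 2)
    (b := y.toReal + ε / 2) (by positivity) (by positivity)
    (by rw [← hsq (M.energyS γ₁)]; gcongr; exact hle x hxt)
    (by rw [← hsq (M.energyS γ₂)]; gcongr; exact hle y hyt)
  rw [M.dLam_eq hΩ]
  refine (iInf₂_le σ ⟨hσ, h0, h1⟩).trans ((ENNReal.rpow_le_rpow hE (by norm_num)).trans ?_)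
  rw [← ENNReal.rpow_natCast, ← ENNReal.rpow_mul]
  norm_num
  rw [show x.toReal + (ε : ℝ) / 2 + (y.toReal + ε / 2) = x.toReal + y.toReal + ε by ring,
    ENNReal.ofReal_add (by positivity) hε'.le,
    ENNReal.ofReal_add (by positivity) (by positivity), ENNReal.ofReal_toReal hxt,
    ENNReal.ofReal_toReal hyt, ENNReal.ofReal_coe_nnreal]

end Model

end Reparametrization

/-! ### The Wasserstein distance is symmetric and satisfies the triangle inequality. -/

section WassersteinMetric

variable {d : ℕ} {Ω : Set (V d)}

lemma W_comm_le (μ ν : ProbOn Ω) : W μ ν ≤ W ν μ := by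
  unfold W
  refine ENNReal.rpow_le_rpow (le_iInf₂ fun q hq => ?_) (by norm_num)
  refine (iInf₂_le (q.map Prod.swap) ⟨?_, ?_⟩).trans (le_of_eq ?_)
  · rw [lintegral_map (by fun_prop) measurable_swap]
    exact lintegral_congr fun p => by rw [Prod.fst_swap, Prod.snd_swap, ← enorm_neg, neg_sub]
  · rw [Measure.map_map measurable_fst measurable_swap]
    exact hq.2
  · rw [Measure.map_map measurable_snd measurable_swap]
    exact hq.1

lemma W_comm (μ ν : ProbOn Ω) : W μ ν = W ν μ := le_antisymm (W_comm_le _ _) (W_comm_le _ _)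

/-- The square root is an order isomorphism of `ℝ≥0∞` and commutes with infima; with an `L²` norm
under the infimum, Minkowski's inequality becomes available. -/
lemma W_eq_iInf (μ ν : ProbOn Ω) :
    W μ ν = ⨅ q ∈ {q : Measure (V d × V d) | q.map Prod.fst = μ.1 ∧ q.map Prod.snd = ν.1},
      eLpNorm (fun p : V d × V d => p.1 - p.2) 2 q := by
  have h : ∀ q : Measure (V d × V d), eLpNorm (fun p : V d × V d => p.1 - p.2) 2 q =
      ENNReal.orderIsoRpow (1 / 2 : ℝ) (by norm_num) (∫⁻ p, ‖p.1 - p.2‖ₑ ^ 2 ∂q) := by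
    intro q
    rw [eLpNorm_eq_lintegral_rpow_enorm_toReal (by norm_num) (by norm_num)]
    simp
  simp only [h, ← OrderIso.map_iInf]
  rfl

/-- Two couplings with a common marginal can be glued. -/
lemma exists_gluing {X : Type*} [MeasurableSpace X] [StandardBorelSpace X] [Nonempty X]
    (q₁ q₂ : Measure (X × X)) [IsProbabilityMeasure q₁] [IsProbabilityMeasure q₂]
    (h : q₁.map Prod.snd = q₂.map Prod.fst) :
    ∃ q : Measure ((X × X) × X), q.map Prod.fst = q₁ ∧ q.map (fun p => (p.1.2, p.2)) = q₂ := by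
  -- The third coordinate is drawn from the conditional law of `q₂` given the second coordinate of
  -- `q₁`.
  refine ⟨q₁.compProd (q₂.condKernel.comap Prod.snd measurable_snd), Measure.fst_compProd _ _, ?_⟩
  ext s hs
  have hm : Measurable fun p : (X × X) × X => (p.1.2, p.2) := by fun_prop
  rw [Measure.map_apply hm hs, Measure.compProd_apply (hm hs)]
  conv_rhs => rw [← q₂.disintegrate q₂.condKernel]
  rw [Measure.compProd_apply hs, Measure.fst, ← h, lintegral_map _ measurable_snd]
  · rfl
  · exact ProbabilityTheory.Kernel.measurable_kernel_prodMk_left hs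

/-- Gluing puts both couplings on one space, where `x - z = (x - y) + (y - z)` and Minkowski's
inequality applies. -/
lemma W_triangle (μ ν κ : ProbOn Ω) : W μ κ ≤ W μ ν + W ν κ := by
  rw [W_eq_iInf, W_eq_iInf μ ν, W_eq_iInf ν κ]
  refine ENNReal.le_iInf₂_add_iInf₂ fun q₁ h₁ q₂ h₂ => ?_
  have i₁ : IsProbabilityMeasure q₁ := by
    have := μ.2.1
    rw [← h₁.1] at this
    exact (Measure.isProbabilityMeasure_map_iff measurable_fst.aemeasurable).1 this
  have i₂ : IsProbabilityMeasure q₂ := by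
    have := ν.2.1
    rw [← h₂.1] at this
    exact (Measure.isProbabilityMeasure_map_iff measurable_fst.aemeasurable).1 this
  obtain ⟨q, hq₁, hq₂⟩ := exists_gluing q₁ q₂ (h₁.2.trans h₂.1.symm)
  have m₁ : Measurable fun p : (V d × V d) × V d => (p.1.2, p.2) := by fun_prop
  have m₂ : Measurable fun p : (V d × V d) × V d => (p.1.1, p.2) := by fun_prop
  have hsm : ∀ r : Measure (V d × V d),
      AEStronglyMeasurable (fun p : V d × V d => p.1 - p.2) r := fun r => by fun_prop
  refine (iInf₂_le (q.map fun p => (p.1.1, p.2)) ⟨?_, ?_⟩).trans ?_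
  · rw [← hq₁, ← hq₂, eLpNorm_map_measure (hsm _) m₂.aemeasurable,
      eLpNorm_map_measure (hsm _) m₁.aemeasurable,
      eLpNorm_map_measure (hsm _) measurable_fst.aemeasurable]
    refine le_trans (le_of_eq ?_) (eLpNorm_add_le (by fun_prop) (by fun_prop) (by norm_num))
    congr 1
    ext1 p
    simp
  · rw [Measure.map_map measurable_fst m₂, ← h₁.1, ← hq₁,
      Measure.map_map measurable_fst measurable_fst]
    rfl
  · rw [Measure.map_map measurable_snd m₂, ← h₂.2, ← hq₂, Measure.map_map measurable_snd m₁]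
    rfl

end WassersteinMetric

/-! ### Equivalence of the metrics and compactness. -/

section MainTheorem

set_option linter.unusedSectionVars false

variable {F : Type*} [NormedAddCommGroup F] [NormedSpace ℝ F]
  {H : Type*} [TopologicalSpace H] {I : ModelWithCorners ℝ F H}
  {S : Type*} [MetricSpace S] [ChartedSpace H S] [IsManifold I ∞ S]
  [RiemannianBundle (fun x : S => TangentSpace I x)] {d : ℕ} {Ω : Set (V d)}

lemma isMetricOn_edist : IsMetricOn univ (fun x y : S => edist x y) where
  finite _ _ _ _ := edist_ne_top _ _
  eq_zero_iff _ _ _ _ := edist_eq_zero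
  symm _ _ _ _ := edist_comm _ _
  triangle _ _ _ _ _ _ := edist_triangle _ _ _

/-- A symmetric function that satisfies the triangle inequality and is comparable to a metric is
a metric. -/
lemma AreEquivalentMetricsOn.of_bounds {X : Type*} {A : Set X} {δ₁ δ₂ : X → X → ℝ≥0∞}
    (h₁ : IsMetricOn A δ₁) (symm : ∀ x ∈ A, ∀ y ∈ A, δ₂ x y = δ₂ y x)
    (triangle : ∀ x ∈ A, ∀ y ∈ A, ∀ z ∈ A, δ₂ x z ≤ δ₂ x y + δ₂ y z) {C₁ C₂ : ℝ≥0}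
    (hC : 0 < C₁) (hb₁ : ∀ x ∈ A, ∀ y ∈ A, δ₁ x y ≤ C₁ * δ₂ x y)
    (hb₂ : ∀ x ∈ A, ∀ y ∈ A, δ₂ x y ≤ C₂ * δ₁ x y) : AreEquivalentMetricsOn A δ₁ δ₂ where
  left := h₁
  right :=
    { finite := fun x hx y hy =>
        ((hb₂ x hx y hy).trans_lt (ENNReal.mul_lt_top ENNReal.coe_lt_top
          (h₁.finite x hx y hy).lt_top)).ne
      eq_zero_iff := fun x hx y hy => by
        rw [← h₁.eq_zero_iff x hx y hy]
        constructor
        · intro h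
          simpa [h] using hb₁ x hx y hy
        · intro h
          simpa [h] using hb₂ x hx y hy
      symm := symm
      triangle := triangle }
  bounds := ⟨C₁ + C₂, by positivity, fun x hx y hy =>
    ⟨(hb₁ x hx y hy).trans (by gcongr; simp), (hb₂ x hx y hy).trans (by gcongr; simp)⟩⟩

namespace Model

/-- `W` is a metric on `Λ`. -/
lemma isMetricOn_W (M : Model I S Ω) : IsMetricOn M.Lam W := by
  obtain ⟨C, -, h⟩ := M.E_bilipschitz
  refine ⟨?_, ?_, fun μ _ ν _ => W_comm μ ν, fun μ _ ν _ κ _ => W_triangle μ ν κ⟩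
  · rintro _ ⟨θ, rfl⟩ _ ⟨θ', rfl⟩
    exact ((h θ θ').1.trans_lt (ENNReal.mul_lt_top ENNReal.coe_lt_top (edist_lt_top _ _))).ne
  · rintro _ ⟨θ, rfl⟩ _ ⟨θ', rfl⟩
    rw [M.E_injective.eq_iff, ← edist_eq_zero (x := θ)]
    constructor
    · intro h0
      simpa [h0] using (h θ θ').2
    · intro h0
      simpa [h0] using (h θ θ').1

variable [IsContMDiffRiemannianBundle I ∞ F (fun x : S => TangentSpace I x)]
  [IsRiemannianManifold I S] [FiniteDimensional ℝ F]

/-- The bounds close up in the cycle `d_S ≤ K W ≤ K d_Λ ≤ K C d_S`. -/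
lemma areEquivalentMetricsOn_dLam (M : Model I S Ω) (hΩ : IsCompact Ω) :
    AreEquivalentMetricsOn univ (fun θ₀ θ₁ : S => edist θ₀ θ₁) M.dLam := by
  obtain ⟨C, -, h⟩ := M.exists_dLam_bounds hΩ
  obtain ⟨K, hK, hE⟩ := M.E_bilipschitz
  exact .of_bounds isMetricOn_edist (fun _ _ _ _ => M.dLam_comm hΩ _ _)
    (fun _ _ _ _ _ _ => M.dLam_triangle hΩ _ _ _) hK
    (fun θ _ θ' _ => (hE θ θ').2.trans (by gcongr; exact (h θ θ').2)) fun θ _ θ' _ => (h θ θ').1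

lemma areEquivalentMetricsOn_WLam (M : Model I S Ω) (hΩ : IsCompact Ω) :
    AreEquivalentMetricsOn M.Lam W M.WLam := by
  obtain ⟨C, -, h⟩ := M.exists_dLam_bounds hΩ
  obtain ⟨K, -, hE⟩ := M.E_bilipschitz
  refine .of_bounds (C₁ := 1) (C₂ := C * K) M.isMetricOn_W ?_ ?_ one_pos ?_ ?_
  · rintro _ ⟨θ, rfl⟩ _ ⟨θ', rfl⟩
    exact M.dLam_comm hΩ θ θ'
  · rintro _ ⟨θ, rfl⟩ _ ⟨θ', rfl⟩ _ ⟨θ'', rfl⟩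
    exact M.dLam_triangle hΩ θ θ' θ''
  · rintro _ ⟨θ, rfl⟩ _ ⟨θ', rfl⟩
    rw [ENNReal.coe_one, one_mul]
    exact (h θ θ').2
  · rintro _ ⟨θ, rfl⟩ _ ⟨θ', rfl⟩
    rw [ENNReal.coe_mul, mul_assoc]
    refine (h θ θ').1.trans ?_
    gcongr
    exact (hE θ θ').2

/-- `(Λ, W_Λ)` is a compact metric space. -/
lemma exists_compact_metricSpace (M : Model I S Ω) (hΩ : IsCompact Ω) [CompactSpace S] :
    ∃ _ : MetricSpace M.Lam,
      (∀ μ ν : M.Lam, edist μ ν = M.WLam μ.1 ν.1) ∧ CompactSpace M.Lam := by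
  have hm := (M.areEquivalentMetricsOn_WLam hΩ).right
  obtain ⟨C, -, h⟩ := M.exists_dLam_bounds hΩ
  let e : EMetricSpace M.Lam :=
    { edist := fun μ ν => M.WLam μ.1 ν.1
      edist_self := fun μ => (hm.eq_zero_iff _ μ.2 _ μ.2).2 rfl
      edist_comm := fun μ ν => hm.symm _ μ.2 _ ν.2
      edist_triangle := fun μ ν κ => hm.triangle _ μ.2 _ ν.2 _ κ.2
      eq_of_edist_eq_zero := fun {μ ν} h0 => Subtype.ext ((hm.eq_zero_iff _ μ.2 _ ν.2).1 h0) }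
  refine ⟨EMetricSpace.toMetricSpace fun μ ν => hm.finite _ μ.2 _ ν.2, fun _ _ => rfl, ?_⟩
  -- The bound `d_Λ ≤ C d_S` makes `E` Lipschitz into `(Λ, W_Λ)`, and a continuous image of the
  -- compact space `S` is compact.
  have hcont : Continuous fun θ : S => (⟨M.E θ, θ, rfl⟩ : M.Lam) :=
    LipschitzWith.continuous (K := C) fun θ θ' => (h θ θ').1
  have hsurj : Function.Surjective fun θ : S => (⟨M.E θ, θ, rfl⟩ : M.Lam) := by
    rintro ⟨_, θ, rfl⟩
    exact ⟨θ, rfl⟩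
  exact hsurj.compactSpace hcont

end Model

end MainTheorem

end WSub

end

theorem mainTheorem8
    {d : ℕ} (Ω : Set (WSub.V d)) (hΩ_compact : IsCompact Ω) (hΩ_convex : Convex ℝ Ω)
    {F : Type*} [NormedAddCommGroup F] [NormedSpace ℝ F] [FiniteDimensional ℝ F]
    {H : Type*} [TopologicalSpace H] (I : ModelWithCorners ℝ F H)
    (S : Type*) [MetricSpace S] [CompactSpace S] [ConnectedSpace S]
    [ChartedSpace H S] [IsManifold I ∞ S]
    [RiemannianBundle (fun x : S => TangentSpace I x)]
    [IsContMDiffRiemannianBundle I ∞ F (fun x : S => TangentSpace I x)]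
    [IsRiemannianManifold I S]
    (M : WSub.Model I S Ω) :
    (∀ θ₀ θ₁ : S, M.dLam θ₀ θ₁ =
      ⨅ γ ∈ {γ : ℝ → S | WSub.IsLipPath γ ∧ γ 0 = θ₀ ∧ γ 1 = θ₁},
        M.energyS γ ^ (1 / 2 : ℝ)) ∧
    WSub.AreEquivalentMetricsOn Set.univ (fun θ₀ θ₁ : S => edist θ₀ θ₁) M.dLam ∧
    WSub.AreEquivalentMetricsOn M.Lam WSub.W M.WLam ∧
    ∃ _ : MetricSpace M.Lam,
      (∀ μ ν : M.Lam, edist μ ν = M.WLam μ.1 ν.1) ∧ CompactSpace M.Lam := by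
  exact ⟨M.dLam_eq hΩ_compact, M.areEquivalentMetricsOn_dLam hΩ_compact,
    M.areEquivalentMetricsOn_WLam hΩ_compact, M.exists_compact_metricSpace hΩ_compact⟩
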